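/- **Setting.** Fix a key length $\kappa\ge 1$ and an output length $\ell$. Let $\mathcal H:\{0,1\}^{2\kappa}\to\{0,1\}^{\ell}$ be a uniformly random function (the quantum random oracle), available as the unitary $|x\rangle|y\rangle\mapsto|x\rangle|y\oplus\mathcal H(x)\rangle$. *The scheme $\mathsf{CL}$.* For keys $k_1,\dots,k_j\in\{0,1\}^\kappa$ ($j=3$ or $j=1$) and a message $m$ of at most $\ell$ bits, $\mathsf{Enc}_{k_1,\dots,k_j}(m)$ samples $R_1,\dots,R_j,R_1',\dots,R_j'$ uniformly from $\{0,1\}^\kappa$ and outputs $$\Big(R_1,\dots,R_j,\ \mathcal H(k_1\|R_1)\oplus\dots\oplus\mathcal H(k_j\|R_j)\oplus m,\ \big(R_i',\mathcal H(k_i\|R_i')\big)_{i=1}^{j}\Big),$$ where the masks of $m$ are truncated to the length of $m$. *The scheme $\mathsf{GBC}_{\mathsf{CL}}$.* Let $C$ be a public circuit of $L$ gates on $N$ qubits, each gate being a Toffoli gate on three distinct qubits or a phase gate $R_Z(\pi/n)$, $n\ge1$; assume that $\ell\ge 3\kappa$ if $C$ has a Toffoli gate and $2^\ell\ge n$ for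 each phase gate. Each Toffoli gate starts three new wires, a phase gate none, and wires are numbered within $N+3L$ labels. Independently for each wire $w$ a pair $(k^w_0,k^w_1)$ of *distinct* keys is drawn uniformly from $\{0,1\}^\kappa$. The encryption of an $N$-qubit state $\rho$ is $(\mathsf{Et}_K(\rho),\mathsf{TAB}(K))$, where $\mathsf{Et}_K:|x_1\cdots x_N\rangle\mapsto|k^1_{x_1}\rangle\cdots|k^N_{x_N}\rangle$ uses the keys of the $N$ input wires, and $\mathsf{TAB}(K)$ is the list of the following garbled tables, one entry per gate: * for a Toffoli gate with input wires $w_1,w_2,w_3$ (target $w_3$) and output wires $v_1,v_2,v_3$: the eight rows $\mathsf{Enc}_{k^{w_1}_a,k^{w_2}_b,k^{w_3}_c}\big(k^{v_1}_a\|k^{v_2}_b\|k^{v_3}_{c\oplus ab}\big)$ and, as a second table, the eight rows $\mathsf{Enc}_{k^{v_1}_a,k^{v_2}_b,k^{v_3}_{c\oplus ab}}\big(k^{w_1}_a\|k^{w_2}_b\|k^{w_3}_c\big)$, for $a,b,c\in\{0,1\}$, each table in an independent uniformly random order; * for $R_Z(\pi/n)$ on wire $w$: with $m\in\mathbb Z_n$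 uniform, the two rows $\mathsf{Enc}_{k^w_0}(m)$, $\mathsf{Enc}_{k^w_1}(m+1)$ in uniformly random order, elements of $\mathbb Z_n$ being written in binary. *The one-shot qIND-CPA game.* The adversary $\mathcal A$ prepares a state $\rho$ of an $N$-qubit message register and a reference register, possibly with quantum queries to $\mathcal H$. If $b=1$ the challenger encrypts the message register of $\rho$; if $b=0$ it encrypts $|0^N\rangle\langle 0^N|$ instead, next to the reduced state of $\rho$ on the reference register. The adversary receives the result, makes further quantum queries to $\mathcal H$ and outputs a bit $b'$. Its advantage is $\mathsf{Adv}(\mathcal A)=|\Pr(b'=1\mid b=1)-\Pr(b'=1\mid b=0)|$, the probabilities being over the keys, the oracle, all encryption randomness and the measurement. The number of qubits of the message register that are quantum is $N_q$: there is a set $Q$ of $N_q$ of the $N$ positions such that $\rho$ is, for every oracle function, block diagonal with respect to the computational-basis values of the positions outside $Q$. **Theorem.** 1. There is a fixed polynomial $\mathsf{poly}$, which depends neither on the adversary nor on any parameter, such that for all $\kappa\ge1,\ell,N,L,N_q,q$, all circuits $C$ as above and all adversaries $\mathcal A$ (of unbounded computing power) that make at most $q$ quantum queries to $\mathcal H$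 in total and whose submitted state has $N_q$ quantum positions as above, $$\mathsf{Adv}(\mathcal A)\le \mathsf{poly}(q,N,L)\cdot 2^{-\frac14(\kappa-4N_q)} .$$ 2. Consequently the advantage is negligible in $\kappa-4N_q$: for every family $(C_\eta,\mathcal A_\eta)_{\eta\in\mathbb N}$ of circuits and adversaries with key lengths $\kappa(\eta)=\eta+4N_q(\eta)$, such that $N(\eta)$, $L(\eta)$ and the number of oracle queries of $\mathcal A_\eta$ are bounded by a polynomial in $\eta$ (in particular for every BQP adversary with security parameter $\eta=\kappa-4N_q$), $\mathsf{Adv}(\mathcal A_\eta)$ is a negligible function of $\eta$, that is, $\eta^c\,\mathsf{Adv}(\mathcal A_\eta)\to0$ for every $c\in\mathbb N$. -/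

import Mathlib

open scoped BigOperators ComplexOrder Kronecker Matrix

namespace GBC

/-! ### Bits and the random oracle -/

/-- Bits; addition is XOR and multiplication is AND. -/
abbrev Bit := ZMod 2

/-- Bit strings of length `n`; addition is bitwise XOR. -/
abbrev BV (n : ℕ) := Fin n → Bit

instance (n : ℕ) : DecidableEq (BV n) := inferInstance

/-- A (fixed) oracle function `H`, to be evaluated at `k ‖ R` with `k`, `R` of length `κ`;
its output length is `ℓ`. The random oracle is a uniformly random element of this type. -/
abbrev Oracle (κ ℓ : ℕ) := BV κ × BV κ → BV ℓ

/-! ### The multi-key encryption scheme with key tags -/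

/-- Ciphertexts under `j` keys of an `s`-bit message: the paddings `R_i`, the masked message, and
the key tags `(R'_i, H(k_i ‖ R'_i))`. -/
def Ciphertext (κ ℓ j s : ℕ) : Type := (Fin j → BV κ) × BV s × (Fin j → BV κ × BV ℓ)

/-- Encryption randomness under `j` keys: the paddings for the message and those for the tags. -/
def EncRand (κ j : ℕ) : Type := (Fin j → BV κ) × (Fin j → BV κ)

instance (κ ℓ j s : ℕ) : DecidableEq (Ciphertext κ ℓ j s) :=
  inferInstanceAs (DecidableEq ((Fin j → BV κ) × BV s × (Fin j → BV κ × BV ℓ)))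

instance (κ ℓ j s : ℕ) : Fintype (Ciphertext κ ℓ j s) :=
  inferInstanceAs (Fintype ((Fin j → BV κ) × BV s × (Fin j → BV κ × BV ℓ)))

instance (κ j : ℕ) : Fintype (EncRand κ j) :=
  inferInstanceAs (Fintype ((Fin j → BV κ) × (Fin j → BV κ)))

/-- `Enc_{k_1,…,k_j}(m)`: the message is XORed with the sum of the masks `H(k_i ‖ R_i)`, of which
the first `s` bits are used. -/
def clEnc {κ ℓ j s : ℕ} (hs : s ≤ ℓ) (H : Oracle κ ℓ) (k : Fin j → BV κ) (R : EncRand κ j)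
    (m : BV s) : Ciphertext κ ℓ j s :=
  (R.1,
   fun b => (∑ i, H (k i, R.1 i) (Fin.castLE hs b)) + m b,
   fun i => (R.2 i, H (k i, R.2 i)))

/-! ### Circuits and wires -/

/-- A gate on `N` qubits: a Toffoli gate on three distinct qubits (controls `p 0`, `p 1`, target
`p 2`), or the phase gate `R_Z(π / n)` on one qubit. -/
inductive Gate (N : ℕ) : Type
  | toffoli (p : Fin 3 ↪ Fin N) : Gate N
  | phase (w : Fin N) (n : ℕ+) : Gate N

/-- A circuit with `L` gates on `N` qubits. -/
abbrev Circuit (N L : ℕ) := Fin L → Gate N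

/-- The `N + 3 L` wires: the input wires, and three output wires for each gate
(those of a phase gate stay unused). -/
abbrev Wire (N L : ℕ) := Fin N ⊕ (Fin L × Fin 3)

/-- The wire carrying qubit `i` after the first `t` gates. A Toffoli gate starts three new wires, a
phase gate none. -/
def wireAt {N L : ℕ} (C : Circuit N L) : ℕ → Fin N → Wire N L
  | 0, i => Sum.inl i
  | t + 1, i =>
    if h : t < L then
      match C ⟨t, h⟩ with
      | .toffoli p =>
        if i = p 0 then Sum.inr (⟨t, h⟩, 0)
        else if i = p 1 then Sum.inr (⟨t, h⟩, 1)
        else if i = p 2 then Sum.inr (⟨t, h⟩, 2)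
        else wireAt C t i
      | .phase _ _ => wireAt C t i
    else wireAt C t i

/-- Length of the messages encrypted in the garbled table of a gate: three keys for a Toffoli gate,
an element of `ℤ_n` in binary for a phase gate. -/
def Gate.msgLen {N : ℕ} (κ : ℕ) : Gate N → ℕ
  | .toffoli _ => κ + κ + κ
  | .phase _ n => Nat.clog 2 n

/-- The oracle output is long enough to mask every message in the garbled tables. -/
def Circuit.Fits {N L : ℕ} (C : Circuit N L) (κ ℓ : ℕ) : Prop :=
  ∀ t, (C t).msgLen κ ≤ ℓ

/-! ### Keys -/

/-- Valid key sets: for each wire `w` two distinct keys `k^w_0`, `k^w_1` of length `κ`. -/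
abbrev KeySet (κ N L : ℕ) := {K : Wire N L → Bit → BV κ // ∀ w, K w 0 ≠ K w 1}

/-! ### Garbled tables -/

/-- Rows of the garbled table of a Toffoli gate. -/
abbrev Row := Bit × Bit × Bit

/-- The garbled table of a gate: a forward and a backward table with eight rows for a Toffoli gate,
one table with two rows for a phase gate. -/
def GateTab (κ ℓ : ℕ) {N : ℕ} : Gate N → Type
  | .toffoli _ => (Row → Ciphertext κ ℓ 3 (κ + κ + κ)) × (Row → Ciphertext κ ℓ 3 (κ + κ + κ))
  | .phase _ n => Bit → Ciphertext κ ℓ 1 (Nat.clog 2 n)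

/-- The randomness of a garbled table, apart from keys and oracle: for each table a permutation of
the rows and the encryption randomness of each row; for a phase gate also `m_0 ∈ ℤ_n`. -/
def GateRand (κ : ℕ) {N : ℕ} : Gate N → Type
  | .toffoli _ =>
    (Equiv.Perm Row × (Row → EncRand κ 3)) × (Equiv.Perm Row × (Row → EncRand κ 3))
  | .phase _ n => ZMod n × Equiv.Perm Bit × (Bit → EncRand κ 1)

instance {κ ℓ N : ℕ} : (g : Gate N) → Fintype (GateTab κ ℓ g)
  | .toffoli _ => inferInstanceAs
      (Fintype ((Row → Ciphertext κ ℓ 3 (κ + κ + κ)) × (Row → Ciphertext κ ℓ 3 (κ + κ + κ))))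
  | .phase _ n => inferInstanceAs (Fintype (Bit → Ciphertext κ ℓ 1 (Nat.clog 2 n)))

instance {κ ℓ N : ℕ} : (g : Gate N) → DecidableEq (GateTab κ ℓ g)
  | .toffoli _ => inferInstanceAs
      (DecidableEq ((Row → Ciphertext κ ℓ 3 (κ + κ + κ)) × (Row → Ciphertext κ ℓ 3 (κ + κ + κ))))
  | .phase _ n => inferInstanceAs (DecidableEq (Bit → Ciphertext κ ℓ 1 (Nat.clog 2 n)))

instance {κ N : ℕ} : (g : Gate N) → Fintype (GateRand κ g)
  | .toffoli _ => inferInstanceAs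
      (Fintype ((Equiv.Perm Row × (Row → EncRand κ 3)) × (Equiv.Perm Row × (Row → EncRand κ 3))))
  | .phase _ n => inferInstanceAs (Fintype (ZMod n × Equiv.Perm Bit × (Bit → EncRand κ 1)))

/-- Concatenation of three keys. -/
def concat3 {κ : ℕ} (k : Fin 3 → BV κ) : BV (κ + κ + κ) :=
  Fin.append (Fin.append (k 0) (k 1)) (k 2)

/-- Binary representation of an element of `ℤ_n`. -/
def phaseMsg (n : ℕ+) (m : ZMod n) : BV (Nat.clog 2 n) :=
  fun b => if m.val.testBit b then 1 else 0

/-- The garbled table of the gate `g`; `win i` and `wout i` are the wires carrying qubit `i` before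
and after the gate. For a Toffoli gate, the row of `(u, v, w)` in the first table encrypts the
output keys for `(u, v, w ⊕ uv)` under the input keys for `(u, v, w)`; the second table does the
opposite. For a phase gate, the row of `u` encrypts `m_0 + u` under `k_u`. -/
def gateTab {κ ℓ N L : ℕ} (H : Oracle κ ℓ) (K : Wire N L → Bit → BV κ)
    (win wout : Fin N → Wire N L) :
    (g : Gate N) → g.msgLen κ ≤ ℓ → GateRand κ g → GateTab κ ℓ g
  | .toffoli p, h, r =>
    let kin : Row → Fin 3 → BV κ := fun a =>
      ![K (win (p 0)) a.1, K (win (p 1)) a.2.1, K (win (p 2)) a.2.2]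
    let kout : Row → Fin 3 → BV κ := fun a =>
      ![K (wout (p 0)) a.1, K (wout (p 1)) a.2.1, K (wout (p 2)) (a.2.2 + a.1 * a.2.1)]
    (fun i => clEnc h H (kin (r.1.1 i)) (r.1.2 (r.1.1 i)) (concat3 (kout (r.1.1 i))),
     fun i => clEnc h H (kout (r.2.1 i)) (r.2.2 (r.2.1 i)) (concat3 (kin (r.2.1 i))))
  | .phase w n, h, r =>
    fun i => clEnc h H (fun _ => K (win w) (r.2.1 i)) (r.2.2 (r.2.1 i))
      (phaseMsg n (if r.2.1 i = 0 then r.1 else r.1 + 1))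

/-- The garbled tables of all gates of a circuit. -/
abbrev Tab (κ ℓ : ℕ) {N L : ℕ} (C : Circuit N L) := (t : Fin L) → GateTab κ ℓ (C t)

/-- The randomness of all garbled tables of a circuit. -/
abbrev TabRand (κ : ℕ) {N L : ℕ} (C : Circuit N L) := (t : Fin L) → GateRand κ (C t)

/-- The list of garbled tables of the circuit `C`. -/
def tab {κ ℓ N L : ℕ} (C : Circuit N L) (hC : C.Fits κ ℓ) (H : Oracle κ ℓ)
    (K : Wire N L → Bit → BV κ) (r : TabRand κ C) : Tab κ ℓ C :=
  fun t => gateTab H K (wireAt C t) (wireAt C (t + 1)) (C t) (hC t) (r t)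

/-! ### Encryption -/

/-- Basis of the plaintext register (`N` qubits). -/
abbrev Msg (N : ℕ) := Fin N → Bit

/-- Basis of the ciphertext register: `κ` qubits for each input qubit, and the garbled tables. -/
abbrev Cipher (κ ℓ : ℕ) {N L : ℕ} (C : Circuit N L) := (Fin N → BV κ) × Tab κ ℓ C

instance {κ ℓ N L : ℕ} (C : Circuit N L) : DecidableEq (Cipher κ ℓ C) := inferInstance

/-- The linear map `|x_1 … x_N⟩ ↦ |k^1_{x_1} … k^N_{x_N}⟩ ⊗ |T⟩`, where `k^i_b` are the keys of the
input wires and `T` is the list of garbled tables. -/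
def encMap {κ ℓ N L : ℕ} (C : Circuit N L) (hC : C.Fits κ ℓ) (H : Oracle κ ℓ)
    (K : KeySet κ N L) (r : TabRand κ C) : Matrix (Cipher κ ℓ C) (Msg N) ℂ :=
  Matrix.of fun c x =>
    if c = (fun i => K.1 (Sum.inl i) (x i), tab C hC H K.1 r) then 1 else 0

/-- Encryption of the plaintext register of a state, with the reference register `R` untouched. -/
def encrypt {κ ℓ N L : ℕ} (C : Circuit N L) (hC : C.Fits κ ℓ) (H : Oracle κ ℓ)
    (K : KeySet κ N L) (r : TabRand κ C) {R : Type} [Fintype R] [DecidableEq R]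
    (ρ : Matrix (Msg N × R) (Msg N × R) ℂ) :
    Matrix (Cipher κ ℓ C × R) (Cipher κ ℓ C × R) ℂ :=
  (encMap C hC H K r ⊗ₖ (1 : Matrix R R ℂ)) * ρ * (encMap C hC H K r ⊗ₖ (1 : Matrix R R ℂ))ᴴ

/-- The state `|0^N⟩⟨0^N| ⊗ ρ_R`, with `ρ_R` the reduced state of `ρ` on the reference register. -/
def zeroMsg {N : ℕ} {R : Type} [Fintype R] (ρ : Matrix (Msg N × R) (Msg N × R) ℂ) :
    Matrix (Msg N × R) (Msg N × R) ℂ :=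
  Matrix.single (0 : Msg N) (0 : Msg N) (1 : ℂ) ⊗ₖ
    Matrix.of fun a b => ∑ x, ρ (x, a) (x, b)

/-! ### Algorithms with quantum oracle access -/

/-- Density matrices. -/
def IsDensity {X : Type} [Fintype X] (ρ : Matrix X X ℂ) : Prop :=
  ρ.PosSemidef ∧ ρ.trace = 1

/-- Basis of the adversary's own registers: query input, query output, and a `d`-dimensional
workspace. -/
abbrev Priv (κ ℓ d : ℕ) := (BV κ × BV κ) × BV ℓ × Fin d

instance (κ ℓ d : ℕ) : DecidableEq (Priv κ ℓ d) := inferInstance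

/-- The oracle unitary `|x⟩|y⟩ ↦ |x⟩|y ⊕ H(x)⟩` on the query registers. -/
def query {κ ℓ d : ℕ} (A : Type) [DecidableEq A] (H : Oracle κ ℓ) :
    Matrix (A × Priv κ ℓ d) (A × Priv κ ℓ d) ℂ :=
  Matrix.of fun z' z =>
    if z' = (z.1, z.2.1, z.2.2.1 + H z.2.1, z.2.2.2) then 1 else 0

/-- The operator `U_q O_H U_{q-1} ⋯ O_H U_0` of an algorithm making `q` oracle queries. -/
def runOp {κ ℓ d : ℕ} {A : Type} [Fintype A] [DecidableEq A] (H : Oracle κ ℓ)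
    (U : ℕ → Matrix.unitaryGroup (A × Priv κ ℓ d) ℂ) :
    ℕ → Matrix (A × Priv κ ℓ d) (A × Priv κ ℓ d) ℂ
  | 0 => (U 0 : Matrix _ _ ℂ)
  | q + 1 => (U (q + 1) : Matrix _ _ ℂ) * query A H * runOp H U q

/-! ### The one-shot game -/

/-- An adversary for the one-shot game. It starts from an arbitrary state of the plaintext register
and its own registers, makes `q₁` oracle queries to prepare the joint state, hands over the
plaintext register, receives the ciphertext register, makes `q₂` further oracle queries, measures
everything in the standard basis, and outputs `1` if the result is in `accept`. -/
structure Adversary (κ ℓ : ℕ) {N L : ℕ} (C : Circuit N L) where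
  d : ℕ
  q₁ : ℕ
  q₂ : ℕ
  init : Matrix (Msg N × Priv κ ℓ d) (Msg N × Priv κ ℓ d) ℂ
  init_density : IsDensity init
  U₁ : ℕ → Matrix.unitaryGroup (Msg N × Priv κ ℓ d) ℂ
  U₂ : ℕ → Matrix.unitaryGroup (Cipher κ ℓ C × Priv κ ℓ d) ℂ
  accept : Finset (Cipher κ ℓ C × Priv κ ℓ d)

namespace Adversary

variable {κ ℓ N L : ℕ} {C : Circuit N L}

/-- The total number of oracle queries. -/
def queries (A : Adversary κ ℓ C) : ℕ := A.q₁ + A.q₂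

/-- The joint state of the plaintext and the reference register that the adversary submits. -/
noncomputable def submitted (A : Adversary κ ℓ C) (H : Oracle κ ℓ) :
    Matrix (Msg N × Priv κ ℓ A.d) (Msg N × Priv κ ℓ A.d) ℂ :=
  runOp H A.U₁ A.q₁ * A.init * (runOp H A.U₁ A.q₁)ᴴ

/-- The plaintext qubits outside `Q` are classical: the submitted state is block diagonal with
respect to their values. -/
def ClassicalOutside (A : Adversary κ ℓ C) (Q : Finset (Fin N)) : Prop :=
  ∀ (H : Oracle κ ℓ) (x y : Msg N) (a b : Priv κ ℓ A.d),
    (∃ i, i ∉ Q ∧ x i ≠ y i) → A.submitted H (x, a) (y, b) = 0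

/-- The probability of output `1` when the adversary gets back the state `σ`. -/
noncomputable def acceptProb (A : Adversary κ ℓ C) (H : Oracle κ ℓ)
    (σ : Matrix (Cipher κ ℓ C × Priv κ ℓ A.d) (Cipher κ ℓ C × Priv κ ℓ A.d) ℂ) : ℝ :=
  ∑ z ∈ A.accept, ((runOp H A.U₂ A.q₂ * σ * (runOp H A.U₂ A.q₂)ᴴ) z z).re

/-- `Pr(b' = 1 | b = 1)`: the submitted plaintext register is encrypted. -/
noncomputable def probReal (A : Adversary κ ℓ C) (hC : C.Fits κ ℓ) : ℝ :=
  𝔼 K : KeySet κ N L, 𝔼 H : Oracle κ ℓ, 𝔼 r : TabRand κ C,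
    A.acceptProb H (encrypt C hC H K r (A.submitted H))

/-- `Pr(b' = 1 | b = 0)`: the string `0^N` is encrypted. -/
noncomputable def probZero (A : Adversary κ ℓ C) (hC : C.Fits κ ℓ) : ℝ :=
  𝔼 K : KeySet κ N L, 𝔼 H : Oracle κ ℓ, 𝔼 r : TabRand κ C,
    A.acceptProb H (encrypt C hC H K r (zeroMsg (A.submitted H)))

/-- The one-shot qIND-CPA distinguishing advantage. -/
noncomputable def advantage (A : Adversary κ ℓ C) (hC : C.Fits κ ℓ) : ℝ :=
  |A.probReal hC - A.probZero hC|

end Adversary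

end GBC

set_option linter.unusedSectionVars false

/-! Fix keys, oracle and table randomness. Encryption then maps basis states to basis states, so the
acceptance probability splits into contributions of the blocks `(x, y)` of the submitted state.
Encrypting `0^N` leaves only diagonal blocks, each encrypted as `0`. It therefore suffices to show
that diagonal blocks do not reveal the plaintext and that off-diagonal blocks contribute little.

Diagonal blocks. On a plaintext `z` every wire carries one bit, which makes one of its keys active
and the other inactive. When all keys are distinct, the oracle may be sampled as a base function
overwritten by independent tables `F₀` at active and `F₁` at inactive keys. The rows of each garbled
table can be labelled relative to the active row, since their order is random; a phase gate also
absorbs the active bit into its uniform element of `ℤ_n`. Then `z` survives only in the messages of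
inactive rows. From `realVec` to `midVec` the adversary loses oracle access at inactive keys (and at
all keys in its first phase). From `midVec` to `idealVec` the inactive rows are replaced by
encryptions of zero: if all paddings are distinct, a translation of `F₁` does this exactly, as in a
one-time pad (`expect_relTab_congr`). The first hop is a hybrid argument over the queries
(`IsQueryAlg`), whose error is the weight of queries at inactive keys. That weight can itself be
computed in the ideal game, where inactive keys are independent of the state. Since `idealVec` does
not involve `z`, `abs_expect_game_sub_le` makes encryptions of `x` and of `0` indistinguishable.

Off-diagonal blocks. The contribution of `x ≠ y` is the overlap of the encryption of `y` with the
result of running the second phase on the encryption of `x`, projecting to acceptance and undoing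
the run (`sum_mem_mul_star_eq`). The encryption of `y` holds an input key that is inactive for `x`,
so a noticeable overlap would mean that `rewind` finds an inactive key with `2 q₂` queries. The
diagonal analysis with the event `keyFound` excludes this. Each `x` has at most `2 ^ N_q` partners
`y` with a nonzero block, which gives the factor `2 ^ N_q` in `acceptProb_sub_le`.

Exponent. Queries hit unknown keys with weight of order `2^{-κ}`. Passing from squared distance to
probability costs a square root, and so does the overlap estimate, which leaves `2^{-κ/4}`. -/

namespace GBC

/-! ### Averages over finite types -/

section Averages

variable {Ω X ι : Type*} [Fintype Ω] [Fintype X]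

theorem expect_comp_equiv (e : Ω ≃ Ω) (f : Ω → ℝ) : 𝔼 ω, f (e ω) = 𝔼 ω, f ω :=
  Fintype.expect_equiv e _ _ fun _ => rfl

theorem expect_mono {f g : Ω → ℝ} (h : ∀ ω, f ω ≤ g ω) : 𝔼 ω, f ω ≤ 𝔼 ω, g ω :=
  Finset.expect_le_expect fun ω _ => h ω

theorem expect_nonneg' {f : Ω → ℝ} (h : ∀ ω, 0 ≤ f ω) : 0 ≤ 𝔼 ω, f ω :=
  Finset.expect_nonneg fun ω _ => h ω

theorem expect_le_of_forall_le [Nonempty Ω] {f : Ω → ℝ} {a : ℝ} (h : ∀ ω, f ω ≤ a) :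
    𝔼 ω, f ω ≤ a :=
  Finset.expect_le Finset.univ_nonempty fun ω _ => h ω

-- Averaging over all translations `e c` does not change the expectation. The event becomes `get ω +
-- c = y ω`, which exactly one `c` satisfies for each `ω`.
open Classical in
theorem expect_ite_shift [AddGroup X] (e : X → Ω ≃ Ω) (get : Ω → X) (y : Ω → X) (f : Ω → ℝ)
    (hget : ∀ c ω, get (e c ω) = get ω + c) (hy : ∀ c ω, y (e c ω) = y ω)
    (hf : ∀ c ω, f (e c ω) = f ω) :
    𝔼 ω, (if get ω = y ω then f ω else 0) = (Fintype.card X : ℝ)⁻¹ * 𝔼 ω, f ω := by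
  have h1 : ∀ c : X, 𝔼 ω, (if get ω = y ω then f ω else 0)
      = 𝔼 ω, (if get ω + c = y ω then f ω else 0) := by
    intro c
    rw [← expect_comp_equiv (e c)]
    simp only [hget, hy, hf]
  have h2 : 𝔼 ω, (if get ω = y ω then f ω else 0)
      = 𝔼 c : X, 𝔼 ω, (if get ω + c = y ω then f ω else 0) := by
    rw [← Fintype.expect_const (ι := X) (𝔼 ω, (if get ω = y ω then f ω else 0))]
    exact Finset.expect_congr rfl fun c _ => h1 c
  rw [h2, Finset.expect_comm, Finset.mul_expect]
  refine Finset.expect_congr rfl fun ω _ => ?_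
  rw [Fintype.expect_eq_sum_div_card]
  simp only [← eq_neg_add_iff_add_eq]
  rw [Finset.sum_ite_eq' Finset.univ (-get ω + y ω)]
  simp [div_eq_inv_mul]

/-- Union bound over ordered pairs: moving coordinate `i` alone shows that it is uniform and
independent of any other coordinate `j`. -/
theorem expect_not_injective_le [Fintype ι] [DecidableEq ι] [AddGroup X] (e : ι → X → Ω ≃ Ω)
    (get : Ω → ι → X)
    (hget : ∀ i c ω j, get (e i c ω) j = get ω j + if j = i then c else 0) [Nonempty Ω]
    [∀ ω, Decidable (Function.Injective (get ω))] :
    𝔼 ω, (if Function.Injective (get ω) then (0 : ℝ) else 1)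
      ≤ (Fintype.card ι : ℝ) ^ 2 / Fintype.card X := by
  classical
  have h1 : ∀ ω, (if Function.Injective (get ω) then (0 : ℝ) else 1)
      ≤ ∑ i, ∑ j, if i = j then (0 : ℝ) else (if get ω i = get ω j then 1 else 0) := by
    intro ω
    have hnn : ∀ i j, (0 : ℝ) ≤ if i = j then (0 : ℝ) else (if get ω i = get ω j then 1 else 0) := by
      intro i j; split_ifs <;> norm_num
    split_ifs with h
    · exact Finset.sum_nonneg fun i _ => Finset.sum_nonneg fun j _ => hnn i j
    · simp only [Function.Injective, not_forall] at h
      obtain ⟨i, j, hij, hne⟩ := h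
      calc (1 : ℝ) = if i = j then (0 : ℝ) else (if get ω i = get ω j then 1 else 0) := by
            rw [if_neg hne, if_pos hij]
        _ ≤ ∑ j, if i = j then (0 : ℝ) else (if get ω i = get ω j then 1 else 0) :=
            Finset.single_le_sum (f := fun j => if i = j then (0 : ℝ) else
              (if get ω i = get ω j then 1 else 0)) (fun j _ => hnn i j) (Finset.mem_univ j)
        _ ≤ _ := Finset.single_le_sum (f := fun i => ∑ j, if i = j then (0 : ℝ) else
              (if get ω i = get ω j then 1 else 0))
              (fun i _ => Finset.sum_nonneg fun j _ => hnn i j) (Finset.mem_univ i)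
  refine (expect_mono h1).trans ?_
  rw [Finset.expect_sum_comm]
  have h2 : ∀ i j, 𝔼 ω, (if i = j then (0 : ℝ) else (if get ω i = get ω j then 1 else 0))
      ≤ (Fintype.card X : ℝ)⁻¹ := by
    intro i j
    by_cases h : i = j
    · simp [h]
    · simp only [if_neg h]
      rw [expect_ite_shift (e i) (fun ω => get ω i) (fun ω => get ω j) (fun _ => 1)]
      · rw [Fintype.expect_one, mul_one]
      · intro c ω; rw [hget, if_pos rfl]
      · intro c ω; rw [hget, if_neg (Ne.symm h), add_zero]
      · intros; rfl
  calc ∑ i, 𝔼 ω, ∑ j, (if i = j then (0 : ℝ) else (if get ω i = get ω j then 1 else 0))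
      = ∑ i, ∑ j, 𝔼 ω, (if i = j then (0 : ℝ) else (if get ω i = get ω j then 1 else 0)) := by
        refine Finset.sum_congr rfl fun i _ => ?_
        rw [Finset.expect_sum_comm]
    _ ≤ ∑ _i : ι, ∑ _j : ι, (Fintype.card X : ℝ)⁻¹ :=
        Finset.sum_le_sum fun i _ => Finset.sum_le_sum fun j _ => h2 i j
    _ = _ := by simp; ring

/-- Averaging over a subtype that contains the good part of a type. -/
theorem expect_subtype_sub_le {p : Ω → Prop} [Fintype {ω // p ω}] [Nonempty {ω // p ω}]
    (good : Ω → Prop) [DecidablePred good] (hgood : ∀ ω, good ω → p ω) (f : Ω → ℝ) (B : ℝ)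
    (hf : ∀ ω, 0 ≤ f ω) (hB : ∀ ω, f ω ≤ B) :
    |(𝔼 ω : {ω // p ω}, f ω.1) - 𝔼 ω, (if good ω then f ω else 0)|
      ≤ B * 𝔼 ω, (if good ω then (0 : ℝ) else 1) := by
  classical
  set a : ℝ := (Fintype.card Ω : ℝ) with ha_def
  set b : ℝ := (Fintype.card {ω // p ω} : ℝ) with hb_def
  have hb : 0 < b := by simpa [b] using (Fintype.card_pos (α := {ω // p ω}))
  have hab : b ≤ a := by
    simp only [a, b]; exact_mod_cast Fintype.card_subtype_le p
  have ha : 0 < a := hb.trans_le hab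
  rw [Fintype.expect_eq_sum_div_card, Fintype.expect_eq_sum_div_card,
    Fintype.expect_eq_sum_div_card]
  set S : ℝ := ∑ ω, (if good ω then f ω else 0)
  set n : ℝ := ∑ ω, (if good ω then (0 : ℝ) else 1)
  set T : ℝ := ∑ ω : {ω // p ω}, f ω.1
  have hT : T = ∑ ω, if p ω then f ω else 0 := by
    rw [← Finset.sum_filter]
    exact (Finset.sum_subtype _ (by simp) _).symm
  have hbs : b = ∑ ω, if p ω then (1 : ℝ) else 0 := by
    simp [b, Fintype.card_subtype]
  have has : a = ∑ _ω : Ω, (1 : ℝ) := by simp [a]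
  have hST : S ≤ T := by
    rw [hT]
    refine Finset.sum_le_sum fun ω _ => ?_
    have := hgood ω; have := hf ω
    split_ifs <;> simp_all
  have hTS : T - S ≤ B * (b - (a - n)) := by
    rw [hT, hbs, has, ← Finset.sum_sub_distrib, ← Finset.sum_sub_distrib,
      ← Finset.sum_sub_distrib, Finset.mul_sum]
    refine Finset.sum_le_sum fun ω _ => ?_
    have := hgood ω; have := hB ω
    split_ifs <;> simp_all
  have hSB : S ≤ B * (a - n) := by
    rw [has, ← Finset.sum_sub_distrib, Finset.mul_sum]
    refine Finset.sum_le_sum fun ω _ => ?_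
    have := hB ω
    split_ifs <;> simp_all
  have hS0 : 0 ≤ S := Finset.sum_nonneg fun ω _ => by have := hf ω; split_ifs <;> simp_all
  have h1 : S / a ≤ T / b := by
    calc S / a ≤ S / b := by gcongr
      _ ≤ T / b := by gcongr
  have h2 : T / b - S / a ≤ B * (n / a) := by
    -- The upper bound is the easy direction applied to the slack `B - f ≥ 0`: its total over the
    -- good part is `B * (a - n) - S`, and dividing by the larger `a` only decreases it.
    have e1 : T / b ≤ B - (B * (a - n) - S) / b := by
      rw [le_sub_iff_add_le, ← add_div, div_le_iff₀ hb]; linarith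
    have e2 : (B * (a - n) - S) / a ≤ (B * (a - n) - S) / b :=
      div_le_div_of_nonneg_left (by linarith) hb hab
    have e3 : (B * (a - n) - S) / a = B - B * (n / a) - S / a := by field_simp
    linarith
  have h3 : (Fintype.card {ω // p ω} : ℝ) = b := rfl
  rw [abs_of_nonneg (by linarith)]
  exact h2

end Averages


/-! ### Squared norms and contractions -/

section Norms

variable {X Y : Type*} [Fintype X] [Fintype Y]

/-- The squared Euclidean norm of a vector. -/
noncomputable def nsq (v : X → ℂ) : ℝ := ∑ i, ‖v i‖ ^ 2

theorem nsq_nonneg (v : X → ℂ) : 0 ≤ nsq v := Finset.sum_nonneg fun _ _ => by positivity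

@[simp] theorem nsq_zero : nsq (0 : X → ℂ) = 0 := by simp [nsq]

/-- The weight stays free because the induction over queries takes `t = 1 / n`; with a constant
weight the error would grow exponentially in the number of queries. -/
theorem norm_sq_add_le_weighted (a b : ℂ) {t : ℝ} (ht : 0 < t) :
    ‖a + b‖ ^ 2 ≤ (1 + t) * ‖a‖ ^ 2 + (1 + t⁻¹) * ‖b‖ ^ 2 := by
  have h1 : ‖a + b‖ ^ 2 ≤ (‖a‖ + ‖b‖) ^ 2 := by gcongr; exact norm_add_le a b
  have h2 : 2 * (‖a‖ * ‖b‖) ≤ t * ‖a‖ ^ 2 + t⁻¹ * ‖b‖ ^ 2 := by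
    have : t * ‖a‖ ^ 2 + t⁻¹ * ‖b‖ ^ 2 - 2 * (‖a‖ * ‖b‖) = t⁻¹ * (t * ‖a‖ - ‖b‖) ^ 2 := by
      field_simp; ring
    have : 0 ≤ t⁻¹ * (t * ‖a‖ - ‖b‖) ^ 2 := by positivity
    linarith
  nlinarith

theorem nsq_add_le_weighted (u v : X → ℂ) {t : ℝ} (ht : 0 < t) :
    nsq (u + v) ≤ (1 + t) * nsq u + (1 + t⁻¹) * nsq v := by
  unfold nsq
  rw [Finset.mul_sum, Finset.mul_sum, ← Finset.sum_add_distrib]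
  exact Finset.sum_le_sum fun i _ => norm_sq_add_le_weighted _ _ ht

theorem nsq_add_le (u v : X → ℂ) : nsq (u + v) ≤ 2 * nsq u + 2 * nsq v := by
  have := nsq_add_le_weighted u v one_pos
  norm_num at this ⊢; linarith

/-- This is `|‖u‖² - ‖v‖²| ≤ ‖u - v‖ (‖u‖ + ‖v‖)` with the product split by the arithmetic-geometric
mean inequality. The right side is linear in squared norms, so it can be averaged directly, and `s`
is chosen at the end. -/
theorem abs_nsq_sub_le (u v : X → ℂ) {s : ℝ} (hs : 0 < s) :
    |nsq u - nsq v| ≤ s⁻¹ * nsq (u - v) + s * (nsq u + nsq v) := by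
  unfold nsq
  rw [← Finset.sum_sub_distrib, ← Finset.sum_add_distrib, Finset.mul_sum, Finset.mul_sum,
    ← Finset.sum_add_distrib]
  refine (Finset.abs_sum_le_sum_abs _ _).trans (Finset.sum_le_sum fun i _ => ?_)
  have h1 : |‖u i‖ ^ 2 - ‖v i‖ ^ 2| = |‖u i‖ - ‖v i‖| * (‖u i‖ + ‖v i‖) := by
    conv_rhs => rw [← abs_of_nonneg (add_nonneg (norm_nonneg (u i)) (norm_nonneg (v i)))]
    rw [← abs_mul]
    congr 1; ring
  have h2 : |‖u i‖ - ‖v i‖| ≤ ‖u i - v i‖ := abs_norm_sub_norm_le _ _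
  rw [h1, Pi.sub_apply]
  set a := ‖u i‖
  set b := ‖v i‖
  set d := ‖u i - v i‖
  have ha : 0 ≤ a := norm_nonneg _
  have hb : 0 ≤ b := norm_nonneg _
  have hd : 0 ≤ d := norm_nonneg _
  have h3 : |a - b| * (a + b) ≤ d * (a + b) := by gcongr
  have h4 : 0 ≤ s⁻¹ * (d - s * ((a + b) / 2)) ^ 2 := by positivity
  have h5 : s⁻¹ * (d - s * ((a + b) / 2)) ^ 2
      = s⁻¹ * d ^ 2 - d * (a + b) + s * ((a + b) / 2) ^ 2 := by field_simp; ring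
  have h6 : ((a + b) / 2) ^ 2 ≤ a ^ 2 + b ^ 2 := by nlinarith [sq_nonneg (a - b)]
  have h7 : s * ((a + b) / 2) ^ 2 ≤ s * (a ^ 2 + b ^ 2) := by gcongr
  linarith

/-- Cauchy-Schwarz in a form that is linear in squared norms, for the same reason. -/
theorem norm_dotProduct_le (u v : X → ℂ) {s : ℝ} (hs : 0 < s) :
    ‖star u ⬝ᵥ v‖ ≤ s * nsq u + s⁻¹ * nsq v := by
  unfold nsq dotProduct
  rw [Finset.mul_sum, Finset.mul_sum, ← Finset.sum_add_distrib]
  refine (norm_sum_le _ _).trans (Finset.sum_le_sum fun i _ => ?_)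
  rw [norm_mul, Pi.star_apply, norm_star]
  have h1 : 0 ≤ s⁻¹ * (s * ‖u i‖ - ‖v i‖ / 2) ^ 2 := by positivity
  have h2 : s⁻¹ * (s * ‖u i‖ - ‖v i‖ / 2) ^ 2
      = s * ‖u i‖ ^ 2 - ‖u i‖ * ‖v i‖ + s⁻¹ * (‖v i‖ / 2) ^ 2 := by field_simp; ring
  have h3 : s⁻¹ * (‖v i‖ / 2) ^ 2 ≤ s⁻¹ * ‖v i‖ ^ 2 := by
    gcongr; linarith [norm_nonneg (v i)]
  linarith

theorem nsq_indicator_le (S : Set X) (v : X → ℂ) : nsq (S.indicator v) ≤ nsq v := by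
  refine Finset.sum_le_sum fun i _ => ?_
  by_cases h : i ∈ S <;> simp [h]

theorem nsq_indicator_iUnion_le {ι : Type*} [Fintype ι] (S : ι → Set X) (v : X → ℂ) :
    nsq ((⋃ i, S i).indicator v) ≤ ∑ i, nsq ((S i).indicator v) := by
  unfold nsq
  rw [Finset.sum_comm]
  refine Finset.sum_le_sum fun x _ => ?_
  by_cases hx : x ∈ ⋃ i, S i
  · obtain ⟨i, hi⟩ := Set.mem_iUnion.1 hx
    rw [Set.indicator_of_mem hx]
    refine le_trans (le_of_eq ?_) (Finset.single_le_sum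
      (f := fun i => ‖(S i).indicator v x‖ ^ 2) (fun j _ => by positivity) (Finset.mem_univ i))
    rw [Set.indicator_of_mem hi]
  · rw [Set.indicator_of_notMem hx]
    simp only [norm_zero, ne_eq, OfNat.ofNat_ne_zero, not_false_eq_true, zero_pow]
    positivity

theorem nsq_indicator_union_le (S T : Set X) (v : X → ℂ) :
    nsq ((S ∪ T).indicator v) ≤ nsq (S.indicator v) + nsq (T.indicator v) := by
  unfold nsq
  rw [← Finset.sum_add_distrib]
  refine Finset.sum_le_sum fun x _ => ?_
  by_cases h1 : x ∈ S <;> by_cases h2 : x ∈ T <;> simp [h1, h2]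

theorem nsq_comp_equiv (e : X ≃ Y) (v : Y → ℂ) : nsq (fun x => v (e x)) = nsq v :=
  Fintype.sum_equiv e _ _ fun _ => rfl

/-- Matrices that do not increase the norm. -/
def Contr (A : Matrix X X ℂ) : Prop := ∀ v, nsq (A *ᵥ v) ≤ nsq v

theorem Contr.mul {A B : Matrix X X ℂ} (hA : Contr A) (hB : Contr B) : Contr (A * B) := fun v => by
  rw [← Matrix.mulVec_mulVec]; exact (hA _).trans (hB v)

theorem nsq_eq_dotProduct (v : X → ℂ) : (nsq v : ℂ) = star v ⬝ᵥ v := by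
  simp only [nsq, dotProduct, Pi.star_apply, Complex.ofReal_sum, Complex.ofReal_pow]
  exact Finset.sum_congr rfl fun i _ => (RCLike.conj_mul (v i)).symm

theorem contr_of_unitary [DecidableEq X] {U : Matrix X X ℂ} (hU : Uᴴ * U = 1) : Contr U := by
  intro v
  have : (nsq (U *ᵥ v) : ℂ) = nsq v := by
    rw [nsq_eq_dotProduct, nsq_eq_dotProduct, Matrix.star_mulVec, Matrix.dotProduct_mulVec,
      Matrix.vecMul_vecMul, hU, Matrix.vecMul_one]
  exact le_of_eq (by exact_mod_cast this)

theorem contr_unitaryGroup [DecidableEq X] (U : Matrix.unitaryGroup X ℂ) :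
    Contr (U : Matrix X X ℂ) :=
  contr_of_unitary (Matrix.mem_unitaryGroup_iff'.1 U.2)

theorem contr_unitaryGroup_conjTranspose [DecidableEq X] (U : Matrix.unitaryGroup X ℂ) :
    Contr (U : Matrix X X ℂ)ᴴ :=
  contr_of_unitary (by
    rw [Matrix.conjTranspose_conjTranspose]; exact Matrix.mem_unitaryGroup_iff.1 U.2)

/-- The projection onto the span of the basis vectors in a finite set. -/
def basisProj [DecidableEq X] (S : Finset X) : Matrix X X ℂ :=
  Matrix.diagonal fun x => if x ∈ S then 1 else 0

theorem basisProj_mulVec [DecidableEq X] (S : Finset X) (v : X → ℂ) :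
    basisProj S *ᵥ v = (S : Set X).indicator v := by
  ext x
  simp only [basisProj, Matrix.mulVec_diagonal, Set.indicator_apply, Finset.mem_coe]
  split_ifs <;> simp

theorem contr_basisProj [DecidableEq X] (S : Finset X) : Contr (basisProj S) := fun v => by
  rw [basisProj_mulVec]; exact nsq_indicator_le _ _

/-- Averaged weight of a vector on a uniformly random value of a register. -/
theorem expect_nsq_indicator_shift {Ω K : Type*} [Fintype Ω] [Fintype K] [AddGroup K]
    (e : K → Ω ≃ Ω) (get : Ω → K) (key : X → K) (ψ : Ω → X → ℂ)
    (hget : ∀ c ω, get (e c ω) = get ω + c) (hψ : ∀ c ω, ψ (e c ω) = ψ ω) :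
    𝔼 ω, nsq ({x | key x = get ω}.indicator (ψ ω))
      = (Fintype.card K : ℝ)⁻¹ * 𝔼 ω, nsq (ψ ω) := by
  classical
  unfold nsq
  rw [Finset.expect_sum_comm, Finset.expect_sum_comm, Finset.mul_sum]
  refine Finset.sum_congr rfl fun x _ => ?_
  rw [← expect_ite_shift e get (fun _ => key x) (fun ω => ‖ψ ω x‖ ^ 2) hget (fun _ _ => rfl)
    (fun c ω => by rw [hψ])]
  refine Finset.expect_congr rfl fun ω _ => ?_
  by_cases h : get ω = key x
  · simp [h]
  · simp [h, Ne.symm h]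

end Norms

/-! ### Query algorithms -/

section Query

variable {κ ℓ d : ℕ} {A : Type} [Fintype A] [DecidableEq A]

theorem bv_add_self {n : ℕ} (v : BV n) : v + v = 0 := by
  ext i; exact CharTwo.add_self_eq_zero _

theorem bv_add_add_cancel {n : ℕ} (v w : BV n) : v + w + w = v := by
  rw [add_assoc, bv_add_self, add_zero]

/-- The permutation of the basis that an oracle query performs. -/
def queryEquiv (A : Type) (d : ℕ) (H : Oracle κ ℓ) : A × Priv κ ℓ d ≃ A × Priv κ ℓ d where
  toFun z := (z.1, z.2.1, z.2.2.1 + H z.2.1, z.2.2.2)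
  invFun z := (z.1, z.2.1, z.2.2.1 + H z.2.1, z.2.2.2)
  left_inv z := by simp [bv_add_add_cancel]
  right_inv z := by simp [bv_add_add_cancel]

theorem query_mulVec (H : Oracle κ ℓ) (v : A × Priv κ ℓ d → ℂ) :
    query A H *ᵥ v = fun z => v (queryEquiv A d H z) := by
  ext z
  simp only [Matrix.mulVec, dotProduct, query, Matrix.of_apply, ite_mul, one_mul, zero_mul]
  have : ∀ z' : A × Priv κ ℓ d, z = (z'.1, z'.2.1, z'.2.2.1 + H z'.2.1, z'.2.2.2)
      ↔ queryEquiv A d H z = z' := fun z' => (Equiv.symm_apply_eq (queryEquiv A d H)).symm.trans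
        (by rw [show (queryEquiv A d H).symm z = queryEquiv A d H z from rfl])
  simp only [this]
  rw [Finset.sum_ite_eq]; simp

theorem contr_query (H : Oracle κ ℓ) : Contr (query (d := d) A H) := fun v => by
  rw [query_mulVec, nsq_comp_equiv]

/-- A query permutes the basis by an involution. Undoing a run therefore uses ordinary queries. -/
theorem query_conjTranspose (H : Oracle κ ℓ) : (query (d := d) A H)ᴴ = query A H := by
  ext z z'
  simp only [Matrix.conjTranspose_apply, query, Matrix.of_apply]
  have : (z' = (z.1, z.2.1, z.2.2.1 + H z.2.1, z.2.2.2))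
      ↔ (z = (z'.1, z'.2.1, z'.2.2.1 + H z'.2.1, z'.2.2.2)) := by
    constructor <;> (intro h; rw [h]; simp [bv_add_add_cancel])
  simp only [this]; split_ifs <;> simp

/-- Basis states whose query register holds a key in `S`. -/
def queryKeyIn (A : Type) (ℓ d : ℕ) (S : Set (BV κ)) : Set (A × Priv κ ℓ d) := {z | z.2.1.1 ∈ S}

/-- A query leaves the query register unchanged, so the part of `v` with key outside `S` is treated
alike by both oracles and cancels. The remaining part enters twice, whence the factor `4`. -/
theorem nsq_query_sub_le {H G : Oracle κ ℓ} {S : Set (BV κ)} (hS : ∀ p, p.1 ∉ S → H p = G p)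
    (v : A × Priv κ ℓ d → ℂ) :
    nsq (query A H *ᵥ v - query A G *ᵥ v) ≤ 4 * nsq ((queryKeyIn A ℓ d S).indicator v) := by
  set w := (queryKeyIn A ℓ d S).indicator v with hw
  have : query A H *ᵥ v - query A G *ᵥ v = query A H *ᵥ w + query A G *ᵥ (-w) := by
    ext z
    simp only [query_mulVec, Pi.sub_apply, Pi.add_apply, Pi.neg_apply, hw]
    by_cases hz : z.2.1.1 ∈ S
    · rw [Set.indicator_of_mem (show queryEquiv A d H z ∈ _ from hz),
        Set.indicator_of_mem (show queryEquiv A d G z ∈ _ from hz), sub_eq_add_neg]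
    · rw [Set.indicator_of_notMem (show queryEquiv A d H z ∉ _ from hz),
        Set.indicator_of_notMem (show queryEquiv A d G z ∉ _ from hz)]
      simp [queryEquiv, hS _ hz]
  rw [this]
  refine (nsq_add_le _ _).trans ?_
  have h1 := contr_query (d := d) (A := A) H w
  have h2 := contr_query (d := d) (A := A) G (-w)
  have h3 : nsq (-w) = nsq w := by simp [nsq]
  linarith

/-- A family of contractions `V H` that is computed with `n` oracle queries. Replacing the oracle
changes the output by no more than the weight of the states before the queries on the inputs where
the oracles differ. -/
def IsQueryAlg (n : ℕ) (V : Oracle κ ℓ → Matrix (A × Priv κ ℓ d) (A × Priv κ ℓ d) ℂ) : Prop :=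
  (∀ H, Contr (V H)) ∧
  ∃ P : ℕ → Oracle κ ℓ → Matrix (A × Priv κ ℓ d) (A × Priv κ ℓ d) ℂ,
    (∀ i G, Contr (P i G)) ∧
    ∀ (H G : Oracle κ ℓ) (S : Set (BV κ)), (∀ p, p.1 ∉ S → H p = G p) → ∀ u,
      nsq (V H *ᵥ u - V G *ᵥ u)
        ≤ n * ∑ i ∈ Finset.range n, 4 * nsq ((queryKeyIn A ℓ d S).indicator (P i G *ᵥ u))

theorem isQueryAlg_const {B : Matrix (A × Priv κ ℓ d) (A × Priv κ ℓ d) ℂ} (hB : Contr B) :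
    IsQueryAlg 0 (fun _ : Oracle κ ℓ => B) :=
  ⟨fun _ => hB, fun _ _ => B, fun _ _ => hB, fun H G S _ u => by simp⟩

theorem IsQueryAlg.mul_left {n : ℕ} {V : Oracle κ ℓ → Matrix (A × Priv κ ℓ d) (A × Priv κ ℓ d) ℂ}
    (hV : IsQueryAlg n V) {B : Matrix (A × Priv κ ℓ d) (A × Priv κ ℓ d) ℂ} (hB : Contr B) :
    IsQueryAlg n (fun H => B * V H) := by
  obtain ⟨h1, P, hP, h2⟩ := hV
  refine ⟨fun H => hB.mul (h1 H), P, hP, fun H G S hS u => ?_⟩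
  rw [← Matrix.mulVec_mulVec, ← Matrix.mulVec_mulVec, ← Matrix.mulVec_sub]
  exact (hB _).trans (h2 H G S hS u)

/-- Hybrid step: the error made so far is carried along by a contraction, and the new error is the
weight on `S` of the state that the algorithm with oracle `G` has before this query. The family of
prefixes is extended by `V` itself. -/
theorem IsQueryAlg.query_mul {n : ℕ}
    {V : Oracle κ ℓ → Matrix (A × Priv κ ℓ d) (A × Priv κ ℓ d) ℂ} (hV : IsQueryAlg n V) :
    IsQueryAlg (n + 1) (fun H => query A H * V H) := by
  obtain ⟨h1, P, hP, h2⟩ := hV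
  refine ⟨fun H => (contr_query H).mul (h1 H), fun i => if i = n then V else P i, ?_, ?_⟩
  · intro i G
    by_cases h : i = n
    · simp only [h, if_true]; exact h1 G
    · simp only [h, if_false]; exact hP i G
  intro H G S hS u
  have hsum : ∑ i ∈ Finset.range n, 4 * nsq ((queryKeyIn A ℓ d S).indicator
      ((if i = n then V else P i) G *ᵥ u))
      = ∑ i ∈ Finset.range n, 4 * nsq ((queryKeyIn A ℓ d S).indicator (P i G *ᵥ u)) := by
    refine Finset.sum_congr rfl fun i hi => ?_
    rw [if_neg (Finset.mem_range.1 hi).ne]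
  beta_reduce
  rw [Finset.sum_range_succ, hsum, if_pos rfl, ← Matrix.mulVec_mulVec, ← Matrix.mulVec_mulVec]
  have hdec : query A H *ᵥ (V H *ᵥ u) - query A G *ᵥ (V G *ᵥ u)
      = query A H *ᵥ (V H *ᵥ u - V G *ᵥ u)
        + (query A H *ᵥ (V G *ᵥ u) - query A G *ᵥ (V G *ᵥ u)) := by
    rw [Matrix.mulVec_sub]; abel
  have hI := h2 H G S hS u
  have hq := nsq_query_sub_le hS (V G *ᵥ u)
  have hc := contr_query (d := d) (A := A) H (V H *ᵥ u - V G *ᵥ u)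
  rw [hdec]
  set a := query A H *ᵥ (V H *ᵥ u - V G *ᵥ u)
  set b := query A H *ᵥ (V G *ᵥ u) - query A G *ᵥ (V G *ᵥ u)
  set s := ∑ i ∈ Finset.range n, 4 * nsq ((queryKeyIn A ℓ d S).indicator (P i G *ᵥ u))
  set t := 4 * nsq ((queryKeyIn A ℓ d S).indicator (V G *ᵥ u))
  -- The weight `1 / n` below makes no sense for `n = 0`; in that case the old error vanishes.
  rcases Nat.eq_zero_or_pos n with rfl | hn
  · have hz : a = 0 := by
      have h0 : nsq a ≤ 0 := by simpa [s] using hc.trans hI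
      have h0' : nsq a = 0 := le_antisymm h0 (nsq_nonneg _)
      ext x
      have := (Finset.sum_eq_zero_iff_of_nonneg (fun i _ => by positivity)).1 h0' x
        (Finset.mem_univ x)
      simpa using this
    rw [hz, zero_add]
    have hs0 : s = 0 := by simp [s]
    rw [hs0]; simpa using hq
  · have hn' : (0 : ℝ) < n := by exact_mod_cast hn
    -- With this weight the old bound `n * s` becomes `(n + 1) * s` and the new term gets the same
    -- factor `n + 1`.
    have hw := nsq_add_le_weighted a b (inv_pos.2 hn')
    rw [inv_inv] at hw
    have e1 : (1 + (n : ℝ)⁻¹) * nsq a ≤ (1 + (n : ℝ)⁻¹) * (n * s) := by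
      gcongr; exact hc.trans hI
    have e2 : (1 + (n : ℝ)) * nsq b ≤ (1 + n) * t := by gcongr
    have e3 : (1 + (n : ℝ)⁻¹) * (n * s) = (n + 1) * s := by field_simp
    push_cast
    nlinarith

theorem isQueryAlg_runOp (U : ℕ → Matrix.unitaryGroup (A × Priv κ ℓ d) ℂ) (q : ℕ) :
    IsQueryAlg q (fun H : Oracle κ ℓ => runOp H U q) := by
  induction q with
  | zero => exact isQueryAlg_const (contr_unitaryGroup _)
  | succ q ih =>
    have := ih.query_mul.mul_left (contr_unitaryGroup (U (q + 1)))
    simpa only [runOp, mul_assoc] using this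

/-- The adjoint of a run applies the inverse unitaries in reverse order with the same self-adjoint
queries in between, so rewinding costs `q` further queries. -/
theorem IsQueryAlg.runOp_conjTranspose_mul (U : ℕ → Matrix.unitaryGroup (A × Priv κ ℓ d) ℂ)
    (q : ℕ) {n : ℕ} {V : Oracle κ ℓ → Matrix (A × Priv κ ℓ d) (A × Priv κ ℓ d) ℂ}
    (hV : IsQueryAlg n V) : IsQueryAlg (n + q) (fun H => (runOp H U q)ᴴ * V H) := by
  induction q generalizing n V with
  | zero =>
    have := hV.mul_left (contr_unitaryGroup_conjTranspose (U 0))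
    simpa only [runOp, Nat.add_zero] using this
  | succ q ih =>
    have := ih (hV.mul_left (contr_unitaryGroup_conjTranspose (U (q + 1)))).query_mul
    rw [show n + (q + 1) = n + 1 + q by ring]
    simpa only [runOp, Matrix.conjTranspose_mul, query_conjTranspose, mul_assoc] using this

end Query

/-! ### Reprogramming the oracle -/

section Reprogram

variable {κ ℓ : ℕ} {W : Type*}

open Classical in
/-- The oracle `G` with the values at inputs starting with the key `k w` replaced by `F w`. -/
noncomputable def reprog (G : Oracle κ ℓ) (k : W → BV κ) (F : W → BV κ → BV ℓ) : Oracle κ ℓ :=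
  fun p => if h : ∃ w, k w = p.1 then F h.choose p.2 else G p

theorem reprog_of_notMem (G : Oracle κ ℓ) {k : W → BV κ} (F : W → BV κ → BV ℓ)
    {p : BV κ × BV κ} (hp : p.1 ∉ Set.range k) : reprog G k F p = G p := by
  rw [reprog, dif_neg (by simpa using hp)]

theorem reprog_apply (G : Oracle κ ℓ) {k : W → BV κ} (hk : Function.Injective k)
    (F : W → BV κ → BV ℓ) (w : W) (R : BV κ) : reprog G k F (k w, R) = F w R := by
  have h : ∃ w', k w' = (k w, R).1 := ⟨w, rfl⟩
  rw [reprog, dif_pos h, hk h.choose_spec]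

/-- Exchange of the oracle values at the given keys with a table. -/
noncomputable def reprogEquiv {k : W → BV κ} (hk : Function.Injective k) :
    Oracle κ ℓ × (W → BV κ → BV ℓ) ≃ Oracle κ ℓ × (W → BV κ → BV ℓ) :=
  Function.Involutive.toPerm (fun x => (reprog x.1 k x.2, fun w R => x.1 (k w, R))) (by
    rintro ⟨G, F⟩
    refine Prod.ext ?_ ?_
    · funext ⟨y, R⟩
      by_cases h : y ∈ Set.range k
      · obtain ⟨w, rfl⟩ := h
        exact reprog_apply _ hk _ w R
      · exact (reprog_of_notMem _ _ h).trans (reprog_of_notMem _ _ h)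
    · funext w R
      exact reprog_apply G hk F w R)

/-- Exchanging the oracle values at the keys with an independent table is a bijection of the pairs,
so the reprogrammed oracle is again uniform. -/
theorem expect_reprog [Fintype W] [DecidableEq W] {k : W → BV κ} (hk : Function.Injective k)
    (f : Oracle κ ℓ → ℝ) :
    𝔼 G : Oracle κ ℓ, 𝔼 F : W → BV κ → BV ℓ, f (reprog G k F) = 𝔼 H, f H := by
  calc 𝔼 G : Oracle κ ℓ, 𝔼 F : W → BV κ → BV ℓ, f (reprog G k F)
      = 𝔼 x : Oracle κ ℓ × (W → BV κ → BV ℓ), f (reprogEquiv hk x).1 :=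
        (Finset.expect_product' Finset.univ Finset.univ fun G F => f (reprog G k F)).symm
    _ = 𝔼 x : Oracle κ ℓ × (W → BV κ → BV ℓ), f x.1 :=
        expect_comp_equiv (reprogEquiv hk) fun x => f x.1
    _ = 𝔼 G : Oracle κ ℓ, 𝔼 _F : W → BV κ → BV ℓ, f G :=
        Finset.expect_product' Finset.univ Finset.univ fun G _ => f G
    _ = 𝔼 H, f H := by simp only [Fintype.expect_const]

end Reprogram

/-! ### Values on wires -/

section Wires

variable {N L : ℕ}

/-- The action of a gate on computational basis states. -/
def Gate.act (v : Fin N → Bit) : Gate N → Fin N → Bit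
  | .toffoli p => fun i => if i = p 2 then v (p 2) + v (p 0) * v (p 1) else v i
  | .phase _ _ => v

/-- The basis state after the first `t` gates on input `z`. -/
def basisVals (C : Circuit N L) (z : Msg N) : ℕ → Fin N → Bit
  | 0 => z
  | t + 1 => if h : t < L then (C ⟨t, h⟩).act (basisVals C z t) else basisVals C z t

/-- The bit carried by each wire on input `z`. -/
def wireVal (C : Circuit N L) (z : Msg N) : Wire N L → Bit
  | .inl i => z i
  | .inr (t, s) => match C t with
    | .toffoli p => basisVals C z (t + 1) (p s)
    -- A phase gate starts no wires; this value is arbitrary.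
    | .phase _ _ => 0

theorem wireVal_wireAt (C : Circuit N L) (z : Msg N) (t : ℕ) (i : Fin N) :
    wireVal C z (wireAt C t i) = basisVals C z t i := by
  induction t with
  | zero => rfl
  | succ t ih =>
    by_cases h : t < L
    · simp only [wireAt, basisVals, dif_pos h]
      cases hg : C ⟨t, h⟩ with
      | toffoli p =>
        have hv : ∀ s, wireVal C z (Sum.inr (⟨t, h⟩, s))
            = (Gate.toffoli p).act (basisVals C z t) (p s) := by
          intro s
          simp only [wireVal, hg, basisVals, dif_pos h]
        simp only
        split_ifs with h0 h1 h2
        · rw [hv, h0]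
        · rw [hv, h1]
        · rw [hv, h2]
        · rw [ih]; simp [Gate.act, h2]
      | phase w n => simpa [Gate.act] using ih
    · simpa [wireAt, basisVals, h] using ih

end Wires

/-! ### Garbled tables indexed relative to the active row -/

section Tables

variable {κ ℓ N L : ℕ}

/-- Encryption with the oracle values at the keys given as functions of the padding. -/
def encWith {j s : ℕ} (hs : s ≤ ℓ) (F : Fin j → BV κ → BV ℓ) (R : EncRand κ j) (m : BV s) :
    Ciphertext κ ℓ j s :=
  (R.1, fun b => (∑ i, F i (R.1 i) (Fin.castLE hs b)) + m b, fun i => (R.2 i, F i (R.2 i)))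

/-- Choice between data of active and inactive keys. -/
def pick {W Y : Type*} (F₀ F₁ : W → Y) (w : W) (b : Bit) : Y := if b = 0 then F₀ w else F₁ w

/-- The bits of the label of a row. -/
def rowBits (a : Row) : Fin 3 → Bit := ![a.1, a.2.1, a.2.2]

/-- The messages of all rows of the garbled table of a gate. -/
def GateMsgs (κ : ℕ) {N : ℕ} : Gate N → Type
  | .toffoli _ => (Row → BV (κ + κ + κ)) × (Row → BV (κ + κ + κ))
  | .phase _ n => Bit → BV (Nat.clog 2 n)

/-- The garbled table of a gate whose rows are labelled relative to the active row: the row `0` uses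
active keys, with oracle values `F₀`, and a nonzero bit in the label of a row stands for an inactive
key, with oracle values `F₁`. -/
def relGateTab (F₀ F₁ : Wire N L → BV κ → BV ℓ) (win wout : Fin N → Wire N L) :
    (g : Gate N) → g.msgLen κ ≤ ℓ → GateMsgs κ g → GateRand κ g → GateTab κ ℓ g
  | .toffoli p, h, M, r =>
    (fun i => encWith h (fun s => pick F₀ F₁ (win (p s)) (rowBits (r.1.1 i) s))
      (r.1.2 (r.1.1 i)) (M.1 (r.1.1 i)),
     fun i => encWith h (fun s => pick F₀ F₁ (wout (p s)) (rowBits (r.2.1 i) s))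
      (r.2.2 (r.2.1 i)) (M.2 (r.2.1 i)))
  | .phase w _, h, M, r =>
    fun i => encWith h (fun _ => pick F₀ F₁ (win w) (r.2.1 i)) (r.2.2 (r.2.1 i)) (M (r.2.1 i))

/-- Messages that depend on active keys only: inactive rows encrypt zero. -/
def idealGateMsgs (K₀ : Wire N L → BV κ) (win wout : Fin N → Wire N L) :
    (g : Gate N) → GateRand κ g → GateMsgs κ g
  | .toffoli p, _ =>
    (fun a => if a = 0 then concat3 (fun s => K₀ (wout (p s))) else 0,
     fun a => if a = 0 then concat3 (fun s => K₀ (win (p s))) else 0)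
  | .phase _ n, r => fun b => if b = 0 then phaseMsg n r.1 else 0

/-- The action of a Toffoli gate on the labels of rows. -/
def rowToffoli : Equiv.Perm Row :=
  Function.Involutive.toPerm (fun a => (a.1, a.2.1, a.2.2 + a.1 * a.2.1)) (by
    rintro ⟨a, b, c⟩
    simp only [add_assoc, CharTwo.add_self_eq_zero, add_zero])

/-- Relabelling of the rows of a table. -/
def relabelRows {α X : Type*} (e : Equiv.Perm α) :
    Equiv.Perm (Equiv.Perm α × (α → X)) where
  toFun x := (x.1.trans e, x.2 ∘ e.symm)
  invFun x := (x.1.trans e.symm, x.2 ∘ e)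
  left_inv x := by ext <;> simp
  right_inv x := by ext <;> simp

/-- The label of the active row of a Toffoli gate. -/
def activeRow (p : Fin 3 ↪ Fin N) (v : Fin N → Bit) : Row := (v (p 0), v (p 1), v (p 2))

/-- Labels of the rows of the forward table relative to the active row. -/
def fwdLabel (a : Row) : Equiv.Perm Row := Equiv.subRight a

/-- Labels of the rows of the backward table relative to the active row, in terms of the
output wires. -/
def bwdLabel (a : Row) : Equiv.Perm Row := rowToffoli.trans (Equiv.subRight (rowToffoli a))

/-- Relabelling of the table randomness relative to the active rows for the values `v` of the
qubits before the gate. -/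
def relabelGate (v : Fin N → Bit) : (g : Gate N) → Equiv.Perm (GateRand κ g)
  | .toffoli p => Equiv.prodCongr (relabelRows (fwdLabel (activeRow p v)))
      (relabelRows (bwdLabel (activeRow p v)))
  | .phase w n => Equiv.prodCongr (Equiv.addRight (if v w = 0 then (0 : ZMod n) else 1))
      (relabelRows (Equiv.subRight (v w)))

/-- The messages encrypted by the scheme, with rows labelled relative to the active row. -/
def realGateMsgs (v : Fin N → Bit) (K : Wire N L → Bit → BV κ) (win wout : Fin N → Wire N L) :
    (g : Gate N) → GateRand κ g → GateMsgs κ g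
  | .toffoli p, _ =>
    (fun a => concat3 (fun s => K (wout (p s))
        (rowBits (rowToffoli ((fwdLabel (activeRow p v)).symm a)) s)),
     fun a => concat3 (fun s => K (win (p s)) (rowBits ((bwdLabel (activeRow p v)).symm a) s)))
  | .phase w n, r => fun b =>
    phaseMsg n (if b + v w = 0 then r.1 - (if v w = 0 then (0 : ZMod n) else 1)
      else r.1 - (if v w = 0 then (0 : ZMod n) else 1) + 1)

/-- The messages of the active rows agree. -/
def AgreeActive : (g : Gate N) → GateMsgs κ g → GateMsgs κ g → Prop
  | .toffoli _, M, M' => M.1 0 = M'.1 0 ∧ M.2 0 = M'.2 0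
  | .phase _ _, M, M' => M 0 = M' 0

theorem bit_cases (b : Bit) : b = 0 ∨ b = 1 := by revert b; decide

/-- The relative label `b - a w` is zero exactly when `b` selects the active key. -/
theorem pick_key (K : Wire N L → Bit → BV κ) (H : Oracle κ ℓ) (a : Wire N L → Bit)
    (w : Wire N L) (b : Bit) :
    pick (fun w R => H (K w (a w), R)) (fun w R => H (K w (a w + 1), R)) w (b - a w)
      = fun R => H (K w b, R) := by
  unfold pick
  generalize hx : a w = x
  rcases bit_cases b with rfl | rfl <;> rcases bit_cases x with rfl | rfl <;>
    simp [hx, CharTwo.add_self_eq_zero]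

theorem vec3_eq {X : Type*} (f : Fin 3 → X) : ![f 0, f 1, f 2] = f := by
  ext i; fin_cases i <;> rfl

theorem rowToffoli_apply (a : Row) : rowToffoli a = (a.1, a.2.1, a.2.2 + a.1 * a.2.1) := rfl

theorem act_toffoli (p : Fin 3 ↪ Fin N) (v : Fin N → Bit) (s : Fin 3) :
    (Gate.toffoli p).act v (p s) = rowBits (rowToffoli (activeRow p v)) s := by
  fin_cases s <;> simp [Gate.act, rowBits, rowToffoli_apply, activeRow]

theorem rowBits_sub (a b : Row) (s : Fin 3) : rowBits (a - b) s = rowBits a s - rowBits b s := by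
  fin_cases s <;> rfl

/-- Translating labels by the active row is absorbed into the random order of the rows and the
indexing of their randomness. For the backward table the translation takes place after `rowToffoli`,
since its rows are keyed by output bits. For a phase gate the active bit is absorbed into the
uniform element of `ℤ_n`. -/
theorem gateTab_eq_relGateTab (H : Oracle κ ℓ) (K : Wire N L → Bit → BV κ) (a : Wire N L → Bit)
    (v : Fin N → Bit) (win wout : Fin N → Wire N L) (g : Gate N)
    (hin : ∀ i, a (win i) = v i) (hout : ∀ i, a (wout i) = g.act v i)
    (h : g.msgLen κ ≤ ℓ) (r : GateRand κ g) :
    gateTab H K win wout g h r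
      = relGateTab (fun w R => H (K w (a w), R)) (fun w R => H (K w (a w + 1), R)) win wout g h
          (realGateMsgs v K win wout g (relabelGate v g r)) (relabelGate v g r) := by
  cases g with
  | toffoli p =>
    have hkin : ∀ b : Row, ![K (win (p 0)) b.1, K (win (p 1)) b.2.1, K (win (p 2)) b.2.2]
        = fun s => K (win (p s)) (rowBits b s) := fun b =>
      vec3_eq fun s => K (win (p s)) (rowBits b s)
    have hkout : ∀ b : Row, ![K (wout (p 0)) b.1, K (wout (p 1)) b.2.1,
        K (wout (p 2)) (b.2.2 + b.1 * b.2.1)]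
        = fun s => K (wout (p s)) (rowBits (rowToffoli b) s) := fun b =>
      vec3_eq fun s => K (wout (p s)) (rowBits (rowToffoli b) s)
    have hain : ∀ s, rowBits (activeRow p v) s = a (win (p s)) := by
      intro s; rw [hin]; fin_cases s <;> rfl
    have haout : ∀ s, rowBits (rowToffoli (activeRow p v)) s = a (wout (p s)) := by
      intro s; rw [hout, act_toffoli]
    refine Prod.ext ?_ ?_
    · funext i
      set e := fwdLabel (activeRow p v) with he
      change clEnc h H ![K (win (p 0)) (r.1.1 i).1, K (win (p 1)) (r.1.1 i).2.1,
          K (win (p 2)) (r.1.1 i).2.2] (r.1.2 (r.1.1 i))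
          (concat3 ![K (wout (p 0)) (r.1.1 i).1, K (wout (p 1)) (r.1.1 i).2.1,
            K (wout (p 2)) ((r.1.1 i).2.2 + (r.1.1 i).1 * (r.1.1 i).2.1)])
        = encWith h (fun s => pick _ _ (win (p s)) (rowBits (e (r.1.1 i)) s))
          (r.1.2 (e.symm (e (r.1.1 i))))
          (concat3 fun s => K (wout (p s)) (rowBits (rowToffoli (e.symm (e (r.1.1 i)))) s))
      rw [e.symm_apply_apply, hkin, hkout, he]
      simp only [fwdLabel, Equiv.subRight_apply, rowBits_sub, hain, pick_key]
      rfl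
    · funext i
      set e := bwdLabel (activeRow p v) with he
      change clEnc h H ![K (wout (p 0)) (r.2.1 i).1, K (wout (p 1)) (r.2.1 i).2.1,
            K (wout (p 2)) ((r.2.1 i).2.2 + (r.2.1 i).1 * (r.2.1 i).2.1)] (r.2.2 (r.2.1 i))
          (concat3 ![K (win (p 0)) (r.2.1 i).1, K (win (p 1)) (r.2.1 i).2.1,
            K (win (p 2)) (r.2.1 i).2.2])
        = encWith h (fun s => pick _ _ (wout (p s)) (rowBits (e (r.2.1 i)) s))
          (r.2.2 (e.symm (e (r.2.1 i))))
          (concat3 fun s => K (win (p s)) (rowBits (e.symm (e (r.2.1 i))) s))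
      rw [e.symm_apply_apply, hkin, hkout, he]
      simp only [bwdLabel, Equiv.trans_apply, Equiv.subRight_apply, rowBits_sub, haout, pick_key]
      rfl
  | phase w n =>
    funext i
    set e : Equiv.Perm Bit := Equiv.subRight (v w) with he
    set c : ZMod n := if v w = 0 then 0 else 1
    change clEnc h H (fun _ => K (win w) (r.2.1 i)) (r.2.2 (r.2.1 i))
          (phaseMsg n (if r.2.1 i = 0 then r.1 else r.1 + 1))
        = encWith h (fun _ => pick _ _ (win w) (e (r.2.1 i)))
          (r.2.2 (e.symm (e (r.2.1 i))))
          (phaseMsg n (if e (r.2.1 i) + v w = 0 then r.1 + c - c else r.1 + c - c + 1))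
    rw [e.symm_apply_apply, he]
    simp only [Equiv.subRight_apply, ← hin w, pick_key, sub_add_cancel, add_sub_cancel_right]
    rfl

/-- The active row of a Toffoli table encrypts active keys only. That of a phase table encrypts the
shifted uniform element itself, whatever the bit on the wire. -/
theorem agreeActive_real_ideal (K : Wire N L → Bit → BV κ) (a : Wire N L → Bit)
    (v : Fin N → Bit) (win wout : Fin N → Wire N L) (g : Gate N)
    (hin : ∀ i, a (win i) = v i) (hout : ∀ i, a (wout i) = g.act v i) (r : GateRand κ g) :
    AgreeActive g (realGateMsgs v K win wout g r)
      (idealGateMsgs (fun w => K w (a w)) win wout g r) := by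
  cases g with
  | toffoli p =>
    have hain : ∀ s, rowBits (activeRow p v) s = a (win (p s)) := by
      intro s; rw [hin]; fin_cases s <;> rfl
    have haout : ∀ s, rowBits (rowToffoli (activeRow p v)) s = a (wout (p s)) := by
      intro s; rw [hout, act_toffoli]
    have e1 : (fwdLabel (activeRow p v)).symm 0 = activeRow p v := by
      rw [Equiv.symm_apply_eq]; simp [fwdLabel]
    have e2 : (bwdLabel (activeRow p v)).symm 0 = activeRow p v := by
      rw [Equiv.symm_apply_eq]; simp [bwdLabel]
    constructor
    · simp only [realGateMsgs, idealGateMsgs, e1, haout, if_true]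
    · simp only [realGateMsgs, idealGateMsgs, e2, hain, if_true]
  | phase w n =>
    simp only [AgreeActive, realGateMsgs, idealGateMsgs, zero_add, if_true]
    split_ifs <;> simp

/-- Zero-extension of a bit string. -/
def padTo (ℓ : ℕ) {s : ℕ} (m : BV s) : BV ℓ := fun i => if h : i.1 < s then m ⟨i.1, h⟩ else 0

theorem padTo_castLE {s : ℕ} (hs : s ≤ ℓ) (m : BV s) (b : Fin s) :
    padTo ℓ m (Fin.castLE hs b) = m b := by
  simp [padTo]

/-- Changing the value of an inactive mask changes the encrypted message. -/
theorem encWith_shift {j s : ℕ} (hs : s ≤ ℓ) (F₀ F₁ : Wire N L → BV κ → BV ℓ)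
    (w : Fin j → Wire N L) (c : Fin j → Bit) (i : Fin j) (R : EncRand κ j) (m m' : BV s)
    (hz : c = 0 → m = m') (hi : c ≠ 0 → c i ≠ 0) (sh : BV κ → BV ℓ)
    (hmask : ∀ s, sh (R.1 s) = if c ≠ 0 ∧ s = i then padTo ℓ (m + m') else 0)
    (htag : ∀ s, sh (R.2 s) = 0) :
    encWith hs (fun s => pick F₀ (fun w x => F₁ w x + sh x) (w s) (c s)) R m
      = encWith hs (fun s => pick F₀ F₁ (w s) (c s)) R m' := by
  unfold encWith
  refine Prod.ext rfl (Prod.ext ?_ ?_)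
  · funext b
    by_cases h : c = 0
    · simp [hz h, pick, h]
    · have hstep : ∀ s, pick F₀ (fun w x => F₁ w x + sh x) (w s) (c s) (R.1 s) (Fin.castLE hs b)
          = pick F₀ F₁ (w s) (c s) (R.1 s) (Fin.castLE hs b)
            + if s = i then (m + m') b else 0 := by
        intro s
        have hm := hmask s
        by_cases hs' : s = i
        · subst hs'
          simp only [ne_eq, h, not_false_eq_true, and_self, if_true] at hm
          simp [pick, hi h, hm, padTo_castLE]
        · simp only [hs', and_false, if_false] at hm
          by_cases hc : c s = 0 <;> simp [pick, hs', hm, hc]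
      simp only [hstep, Finset.sum_add_distrib, Finset.sum_ite_eq', Finset.mem_univ, if_true]
      have h2 : m b + m b = 0 := CharTwo.add_self_eq_zero _
      simp only [Pi.add_apply]
      linear_combination h2
  · funext s
    simp only [pick]
    split_ifs <;> simp [htag]

/-- A position with a nonzero bit. -/
def firstBit (a : Row) : Fin 3 := if a.1 ≠ 0 then 0 else if a.2.1 ≠ 0 then 1 else 2

theorem rowBits_firstBit {a : Row} (h : rowBits a ≠ 0) : rowBits a (firstBit a) ≠ 0 := by
  revert a; decide

theorem rowBits_eq_zero {a : Row} : rowBits a = 0 ↔ a = 0 := by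
  revert a; decide

/-- Indices of the paddings in a garbled table; `true` stands for the forward table and for
paddings of the message, respectively. -/
def PadIdx {N : ℕ} : Gate N → Type
  | .toffoli _ => (Bool × Row) × (Bool × Fin 3)
  | .phase _ _ => Bit × Bool

instance {N : ℕ} : (g : Gate N) → Fintype (PadIdx g)
  | .toffoli _ => inferInstanceAs (Fintype ((Bool × Row) × (Bool × Fin 3)))
  | .phase _ _ => inferInstanceAs (Fintype (Bit × Bool))

instance {N : ℕ} : (g : Gate N) → DecidableEq (PadIdx g)
  | .toffoli _ => inferInstanceAs (DecidableEq ((Bool × Row) × (Bool × Fin 3)))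
  | .phase _ _ => inferInstanceAs (DecidableEq (Bit × Bool))

/-- A Toffoli gate has 2 tables with 8 rows and 3 keys each, and every key comes with one padding
for the message and one for the tag. -/
theorem card_padIdx_le (g : Gate N) : Fintype.card (PadIdx g) ≤ 96 := by
  cases g with
  | toffoli p => exact le_of_eq (by decide +kernel : Fintype.card ((Bool × Row) × (Bool × Fin 3)) = 96)
  | phase w n => exact (by decide : Fintype.card (Bit × Bool) ≤ 96)

/-- The part of the table randomness besides the paddings. -/
def GateSig {N : ℕ} : Gate N → Type
  | .toffoli _ => Equiv.Perm Row × Equiv.Perm Row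
  | .phase _ n => ZMod n × Equiv.Perm Bit

/-- Splitting off the paddings. -/
def gateRandEquiv (κ : ℕ) : (g : Gate N) → GateRand κ g ≃ GateSig g × (PadIdx g → BV κ)
  | .toffoli _ =>
    { toFun := fun r => ((r.1.1, r.2.1), fun i =>
        match i with
        | ((true, a), (true, k)) => (r.1.2 a).1 k
        | ((true, a), (false, k)) => (r.1.2 a).2 k
        | ((false, a), (true, k)) => (r.2.2 a).1 k
        | ((false, a), (false, k)) => (r.2.2 a).2 k)
      invFun := fun x =>
        ((x.1.1, fun a => (fun k => x.2 ((true, a), (true, k)),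
            fun k => x.2 ((true, a), (false, k)))),
         (x.1.2, fun a => (fun k => x.2 ((false, a), (true, k)),
            fun k => x.2 ((false, a), (false, k)))))
      left_inv := fun r => rfl
      right_inv := fun x => by
        refine Prod.ext rfl ?_
        funext i
        rcases i with ⟨⟨_ | _, a⟩, ⟨_ | _, k⟩⟩ <;> rfl }
  | .phase _ _ =>
    { toFun := fun r => ((r.1, r.2.1), fun i =>
        match i with
        | (a, true) => (r.2.2 a).1 0
        | (a, false) => (r.2.2 a).2 0)
      invFun := fun x => (x.1.1, x.1.2, fun a => (fun _ => x.2 (a, true), fun _ => x.2 (a, false)))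
      left_inv := fun r => by
        refine Prod.ext rfl (Prod.ext rfl ?_)
        funext a
        refine Prod.ext ?_ ?_
        · funext k; rw [Subsingleton.elim k 0]
        · funext k; rw [Subsingleton.elim k 0]
      right_inv := fun x => by
        refine Prod.ext rfl ?_
        funext i
        rcases i with ⟨a, _ | _⟩ <;> rfl }

/-- The paddings of a garbled table. -/
def gatePads (g : Gate N) (r : GateRand κ g) : PadIdx g → BV κ := (gateRandEquiv κ g r).2

/-- Changes of the oracle at inactive keys that turn the messages `M` into `M'`. -/
def maskShift (ℓ : ℕ) : (g : Gate N) → GateMsgs κ g → GateMsgs κ g → PadIdx g → BV ℓ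
  | .toffoli _, M, M' => fun i =>
    match i with
    | ((true, a), (true, k)) =>
      if rowBits a ≠ 0 ∧ k = firstBit a then padTo ℓ (M.1 a + M'.1 a) else 0
    | ((false, a), (true, k)) =>
      if rowBits a ≠ 0 ∧ k = firstBit a then padTo ℓ (M.2 a + M'.2 a) else 0
    | (_, (false, _)) => 0
  | .phase _ _, M, M' => fun i =>
    match i with
    | (a, true) => if a ≠ 0 then padTo ℓ (M a + M' a) else 0
    | (_, false) => 0

/-- Each inactive row has an inactive key; changing its mask by the XOR of the two messages
exchanges them. One shift `sh` serves all wires because it is looked up by padding only, and it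
vanishes at the paddings of the tags. -/
theorem relGateTab_shift (F₀ F₁ : Wire N L → BV κ → BV ℓ) (win wout : Fin N → Wire N L)
    (g : Gate N) (h : g.msgLen κ ≤ ℓ) (M M' : GateMsgs κ g) (r : GateRand κ g)
    (hM : AgreeActive g M M') (sh : BV κ → BV ℓ)
    (hsh : ∀ i, sh (gatePads g r i) = maskShift ℓ g M M' i) :
    relGateTab F₀ (fun w x => F₁ w x + sh x) win wout g h M r
      = relGateTab F₀ F₁ win wout g h M' r := by
  cases g with
  | toffoli p =>
    refine Prod.ext ?_ ?_
    · funext i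
      refine encWith_shift h F₀ F₁ (fun s => win (p s)) (rowBits (r.1.1 i)) (firstBit (r.1.1 i))
        (r.1.2 (r.1.1 i)) _ _ (fun h0 => ?_) rowBits_firstBit sh (fun s => ?_) (fun s => ?_)
      · rw [rowBits_eq_zero.1 h0]; exact hM.1
      · exact hsh ((true, r.1.1 i), (true, s))
      · exact hsh ((true, r.1.1 i), (false, s))
    · funext i
      refine encWith_shift h F₀ F₁ (fun s => wout (p s)) (rowBits (r.2.1 i)) (firstBit (r.2.1 i))
        (r.2.2 (r.2.1 i)) _ _ (fun h0 => ?_) rowBits_firstBit sh (fun s => ?_) (fun s => ?_)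
      · rw [rowBits_eq_zero.1 h0]; exact hM.2
      · exact hsh ((false, r.2.1 i), (true, s))
      · exact hsh ((false, r.2.1 i), (false, s))
  | phase w n =>
    funext i
    have hc : ∀ b : Bit, (fun _ : Fin 1 => b) = 0 ↔ b = 0 := fun b =>
      ⟨fun hb => congrFun hb 0, fun hb => by rw [hb]; rfl⟩
    refine encWith_shift h F₀ F₁ (fun _ => win w) (fun _ => r.2.1 i) 0
      (r.2.2 (r.2.1 i)) _ _ (fun h0 => ?_) (fun h0 => (hc _).not.1 h0) sh (fun s => ?_)
      (fun s => ?_)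
    · rw [(hc _).1 h0]; exact hM
    · rw [Subsingleton.elim s 0]
      simp only [and_true, ne_eq, hc]
      exact hsh (r.2.1 i, true)
    · rw [Subsingleton.elim s 0]
      exact hsh (r.2.1 i, false)

/-! ### The tables of a circuit -/

variable (C : Circuit N L)

/-- Messages for all garbled tables of a circuit. -/
abbrev TabMsgs (κ : ℕ) {N L : ℕ} (C : Circuit N L) := (t : Fin L) → GateMsgs κ (C t)

/-- The garbled tables of a circuit, with rows labelled relative to the active rows. -/
def relTab (hC : C.Fits κ ℓ) (F₀ F₁ : Wire N L → BV κ → BV ℓ) (M : TabMsgs κ C)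
    (r : TabRand κ C) : Tab κ ℓ C :=
  fun t => relGateTab F₀ F₁ (wireAt C t) (wireAt C (t + 1)) (C t) (hC t) (M t) (r t)

/-- The ideal messages of all garbled tables. -/
def idealMsgs (K₀ : Wire N L → BV κ) (r : TabRand κ C) : TabMsgs κ C :=
  fun t => idealGateMsgs K₀ (wireAt C t) (wireAt C (t + 1)) (C t) (r t)

/-- The messages of all garbled tables relative to the rows active on input `z`. -/
def realMsgs (z : Msg N) (K : Wire N L → Bit → BV κ) (r : TabRand κ C) : TabMsgs κ C :=
  fun t => realGateMsgs (basisVals C z t) K (wireAt C t) (wireAt C (t + 1)) (C t) (r t)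

/-- Relabelling of the randomness of all tables relative to the rows active on input `z`. -/
def relabel (z : Msg N) : Equiv.Perm (TabRand κ C) :=
  Equiv.piCongrRight fun t => relabelGate (basisVals C z t) (C t)

theorem basisVals_succ (z : Msg N) (t : Fin L) :
    basisVals C z (t + 1) = (C t).act (basisVals C z t) := by
  simp [basisVals]

theorem tab_eq_relTab (hC : C.Fits κ ℓ) (H : Oracle κ ℓ) (K : Wire N L → Bit → BV κ)
    (z : Msg N) (r : TabRand κ C) :
    tab C hC H K r = relTab C hC (fun w R => H (K w (wireVal C z w), R))
      (fun w R => H (K w (wireVal C z w + 1), R)) (realMsgs C z K (relabel C z r))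
      (relabel C z r) := by
  funext t
  refine gateTab_eq_relGateTab H K (wireVal C z) (basisVals C z t) _ _ (C t)
    (fun i => wireVal_wireAt C z t i) (fun i => ?_) (hC t) (r t)
  rw [wireVal_wireAt C z, basisVals_succ]

theorem agreeActive_realMsgs (K : Wire N L → Bit → BV κ) (z : Msg N) (r : TabRand κ C)
    (t : Fin L) :
    AgreeActive (C t) (realMsgs C z K r t) (idealMsgs C (fun w => K w (wireVal C z w)) r t) := by
  refine agreeActive_real_ideal K (wireVal C z) (basisVals C z t) _ _ (C t)
    (fun i => wireVal_wireAt C z t i) (fun i => ?_) (r t)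
  rw [wireVal_wireAt C z, basisVals_succ]

/-- All paddings in the tables of a circuit. -/
def pads (r : TabRand κ C) (i : Σ t, PadIdx (C t)) : BV κ := gatePads (C i.1) (r i.1) i.2

theorem card_sigma_padIdx_le : Fintype.card (Σ t, PadIdx (C t)) ≤ 96 * L := by
  rw [Fintype.card_sigma]
  refine (Finset.sum_le_sum fun t _ => card_padIdx_le (C t)).trans ?_
  simp [mul_comm]

/-- When all paddings are distinct, the messages of inactive rows are perfectly hidden by the oracle
values at inactive keys. -/
theorem expect_relTab_congr (hC : C.Fits κ ℓ) (F₀ : Wire N L → BV κ → BV ℓ)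
    (M M' : TabMsgs κ C) (r : TabRand κ C) (hr : Function.Injective (pads C r))
    (hM : ∀ t, AgreeActive (C t) (M t) (M' t)) (φ : Tab κ ℓ C → ℝ) :
    𝔼 F₁ : Wire N L → BV κ → BV ℓ, φ (relTab C hC F₀ F₁ M r)
      = 𝔼 F₁ : Wire N L → BV κ → BV ℓ, φ (relTab C hC F₀ F₁ M' r) := by
  -- Distinctness of the paddings makes all requirements on the shift compatible, across rows,
  -- tables and gates. The shift does not depend on `F₁`, so translation by it preserves the
  -- average.
  set sh : BV κ → BV ℓ := Function.extend (pads C r)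
    (fun i => maskShift ℓ (C i.1) (M i.1) (M' i.1) i.2) 0 with hsh
  rw [← expect_comp_equiv (Equiv.addRight (fun _ : Wire N L => sh))]
  refine Finset.expect_congr rfl fun F₁ _ => ?_
  congr 1
  funext t
  refine relGateTab_shift F₀ F₁ _ _ (C t) (hC t) (M t) (M' t) (r t) (hM t) sh fun i => ?_
  exact hr.extend_apply _ _ (⟨t, i⟩ : Σ t, PadIdx (C t))

/-- The paddings of all tables as a separate factor. -/
def tabRandEquiv (κ : ℕ) :
    TabRand κ C ≃ ((t : Fin L) → GateSig (C t)) × ((Σ t, PadIdx (C t)) → BV κ) where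
  toFun r := (fun t => (gateRandEquiv κ (C t) (r t)).1, pads C r)
  invFun x := fun t => (gateRandEquiv κ (C t)).symm (x.1 t, fun i => x.2 ⟨t, i⟩)
  left_inv r := by
    funext t
    rw [Equiv.symm_apply_eq]
    rfl
  right_inv x := by
    refine Prod.ext ?_ ?_
    · funext t; simp
    · funext i; simp [pads, gatePads]

/-- By `tabRandEquiv` the paddings form a free factor of the randomness, so each can be translated
separately. -/
theorem expect_not_injective_pads_le [Nonempty (TabRand κ C)] :
    𝔼 r : TabRand κ C, (if Function.Injective (pads C r) then (0 : ℝ) else 1)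
      ≤ (96 * L) ^ 2 / 2 ^ κ := by
  let e : (Σ t, PadIdx (C t)) → BV κ → TabRand κ C ≃ TabRand κ C := fun i c =>
    ((tabRandEquiv C κ).trans
      (Equiv.prodCongr (Equiv.refl _) (Equiv.addRight (Pi.single i c)))).trans
      (tabRandEquiv C κ).symm
  refine (expect_not_injective_le e (pads C) fun i c r j => ?_).trans ?_
  · have h1 : tabRandEquiv C κ (e i c r)
        = ((tabRandEquiv C κ r).1, (tabRandEquiv C κ r).2 + Pi.single i c) := by
      simp only [e, Equiv.trans_apply, Equiv.apply_symm_apply]; rfl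
    have h2 : pads C (e i c r) = (tabRandEquiv C κ (e i c r)).2 := rfl
    rw [h2, h1]
    simp only [Pi.add_apply, Pi.single_apply]
    rfl
  · have h1 : (Fintype.card (BV κ) : ℝ) = 2 ^ κ := by simp [ZMod.card]
    have h2 : (Fintype.card (Σ t, PadIdx (C t)) : ℝ) ≤ 96 * L := by
      exact_mod_cast card_sigma_padIdx_le C
    rw [h1]
    gcongr

end Tables


/-! ### Basis register tensored with a vector, and weights on independent keys. -/

section Vectors

variable {A P : Type*} [Fintype A] [Fintype P]

/-- The vector `|c⟩ ⊗ v`. -/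
def place [DecidableEq A] (c : A) (v : P → ℂ) : A × P → ℂ := fun z => if z.1 = c then v z.2 else 0

theorem nsq_place [DecidableEq A] (c : A) (v : P → ℂ) : nsq (place c v) = nsq v := by
  unfold nsq place
  rw [Fintype.sum_prod_type]
  rw [Finset.sum_eq_single c]
  · simp
  · intro a _ ha; simp [ha]
  · simp

theorem place_sub [DecidableEq A] (c : A) (v w : P → ℂ) :
    place c (v - w) = place c v - place c w := by
  ext z; simp only [place, Pi.sub_apply]; split_ifs <;> simp

/-- The component of a vector at the value `x` of the first register. -/
def block (x : A) (u : A × P → ℂ) : P → ℂ := fun a => u (x, a)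

theorem sum_nsq_block (u : A × P → ℂ) : ∑ x, nsq (block x u) = nsq u := by
  unfold nsq block
  rw [Fintype.sum_prod_type]

theorem block_sub (x : A) (u v : A × P → ℂ) : block x (u - v) = block x u - block x v := rfl

/-- The averaged weight of a vector on uniformly random keys, at least one of which is in its
register. -/
theorem expect_nsq_indicator_exists_le {Ω K J X : Type*} [Fintype Ω] [Fintype K] [AddGroup K]
    [Fintype J] [Fintype X]
    (e : K → Ω ≃ Ω) (get : Ω → J → K) (key : J → X → K) (ψ : Ω → X → ℂ)
    (hget : ∀ c ω j, get (e c ω) j = get ω j + c) (hψ : ∀ c ω, ψ (e c ω) = ψ ω) :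
    𝔼 ω, nsq ({x | ∃ j, key j x = get ω j}.indicator (ψ ω))
      ≤ Fintype.card J / Fintype.card K * 𝔼 ω, nsq (ψ ω) := by
  calc 𝔼 ω, nsq ({x | ∃ j, key j x = get ω j}.indicator (ψ ω))
      ≤ 𝔼 ω, ∑ j, nsq ({x | key j x = get ω j}.indicator (ψ ω)) := by
        refine expect_mono fun ω => ?_
        rw [show {x | ∃ j, key j x = get ω j} = ⋃ j, {x | key j x = get ω j} by ext; simp]
        exact nsq_indicator_iUnion_le _ _
    _ = ∑ _j : J, (Fintype.card K : ℝ)⁻¹ * 𝔼 ω, nsq (ψ ω) := by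
        rw [Finset.expect_sum_comm]
        exact Finset.sum_congr rfl fun j _ =>
          expect_nsq_indicator_shift e (fun ω => get ω j) (key j) ψ (fun c ω => hget c ω j) hψ
    _ = _ := by rw [Finset.sum_const, Finset.card_univ, nsmul_eq_mul]; ring

end Vectors

/-! ### The real, intermediate and ideal games on a common sample space. -/

section Core

variable {κ ℓ N L d : ℕ} (C : Circuit N L)

/-- All random data but the oracle values at inactive keys: active and inactive keys, the oracle at
other inputs, its values at active keys, and the randomness of the tables. -/
abbrev Seed (κ ℓ : ℕ) {N L : ℕ} (C : Circuit N L) :=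
  ((Wire N L → BV κ) × (Wire N L → BV κ)) × Oracle κ ℓ × (Wire N L → BV κ → BV ℓ) × TabRand κ C

/-- All random data. -/
abbrev Sample (κ ℓ : ℕ) {N L : ℕ} (C : Circuit N L) := Seed κ ℓ C × (Wire N L → BV κ → BV ℓ)

instance : Fintype (Seed κ ℓ C) :=
  have : Fintype ((Wire N L → BV κ → BV ℓ) × TabRand κ C) := inferInstance
  have : Fintype (Oracle κ ℓ × (Wire N L → BV κ → BV ℓ) × TabRand κ C) := inferInstance
  instFintypeProd _ _

instance : Fintype (Sample κ ℓ C) := instFintypeProd _ _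

/-- The oracle with active keys reprogrammed. -/
noncomputable def midOracle {C : Circuit N L} (θ : Seed κ ℓ C) : Oracle κ ℓ :=
  reprog θ.2.1 θ.1.1 θ.2.2.1

/-- The oracle with all keys reprogrammed. -/
noncomputable def fullOracle {C : Circuit N L} (ω : Sample κ ℓ C) : Oracle κ ℓ :=
  reprog (midOracle ω.1) ω.1.1.2 ω.2

/-- Key pairs from active and inactive keys. -/
def joinKeys (a : Wire N L → Bit) (k : (Wire N L → BV κ) × (Wire N L → BV κ)) :
    Wire N L → Bit → BV κ := fun w b => if b = a w then k.1 w else k.2 w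

/-- Splitting of key pairs into active and inactive keys. -/
def splitKeys (a : Wire N L → Bit) :
    (Wire N L → Bit → BV κ) ≃ (Wire N L → BV κ) × (Wire N L → BV κ) where
  toFun K := (fun w => K w (a w), fun w => K w (a w + 1))
  invFun := joinKeys a
  left_inv K := by
    funext w b
    simp only [joinKeys]
    generalize a w = x
    rcases bit_cases b with rfl | rfl <;> rcases bit_cases x with rfl | rfl <;>
      simp [CharTwo.add_self_eq_zero]
  right_inv k := by
    refine Prod.ext ?_ ?_
    · funext w; simp [joinKeys]
    · funext w; simp [joinKeys]

/-- Splitting only reindexes the keys, so the event that all keys are distinct does not depend on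
which of them are active. -/
theorem splitKeys_injective_iff (a : Wire N L → Bit) (K : Wire N L → Bit → BV κ) :
    Function.Injective (Sum.elim (splitKeys a K).1 (splitKeys a K).2)
      ↔ Function.Injective (fun p : Wire N L × Bit => K p.1 p.2) := by
  let e : Wire N L ⊕ Wire N L ≃ Wire N L × Bit :=
    { toFun := Sum.elim (fun w => (w, a w)) (fun w => (w, a w + 1))
      invFun := fun p => if p.2 = a p.1 then Sum.inl p.1 else Sum.inr p.1
      left_inv := by rintro (w | w) <;> simp
      right_inv := by
        rintro ⟨w, b⟩
        generalize hx : a w = x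
        rcases bit_cases b with rfl | rfl <;> rcases bit_cases x with rfl | rfl <;>
          simp [hx, CharTwo.add_self_eq_zero] }
  have : Sum.elim (splitKeys a K).1 (splitKeys a K).2
      = (fun p : Wire N L × Bit => K p.1 p.2) ∘ e := by
    funext w; rcases w with w | w <;> rfl
  rw [this, EquivLike.injective_comp]

variable (hC : C.Fits κ ℓ)
  (V : Oracle κ ℓ → Matrix (Cipher κ ℓ C × Priv κ ℓ d) (Cipher κ ℓ C × Priv κ ℓ d) ℂ)
  (W : Oracle κ ℓ → Matrix (Msg N × Priv κ ℓ d) (Msg N × Priv κ ℓ d) ℂ)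
  (b : Msg N × Priv κ ℓ d → ℂ)

/-- The unnormalized state after the second phase, when the first phase uses the oracle `Hw` and
yields the plaintext `x`, and the second phase uses the oracle `Hv` on the ciphertext made of the
keys `k` and the tables `T`. -/
def outVec (Hw Hv : Oracle κ ℓ) (k : Wire N L → BV κ) (T : Tab κ ℓ C) (x : Msg N) :
    Cipher κ ℓ C × Priv κ ℓ d → ℂ :=
  V Hv *ᵥ place ((fun i => k (Sum.inl i), T) : Cipher κ ℓ C) (block x (W Hw *ᵥ b))

/-- The output of the game on sampled data for the plaintext `x` encrypted as `z`. -/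
noncomputable def realVec (z x : Msg N) (ω : Sample κ ℓ C) : Cipher κ ℓ C × Priv κ ℓ d → ℂ :=
  outVec C V W b (fullOracle ω) (fullOracle ω) ω.1.1.1
    (relTab C hC ω.1.2.2.1 ω.2 (realMsgs C z (joinKeys (wireVal C z) ω.1.1) ω.1.2.2.2) ω.1.2.2.2) x

/-- The output when the algorithm has no access to oracle values at inactive keys. -/
noncomputable def midVec (z x : Msg N) (ω : Sample κ ℓ C) : Cipher κ ℓ C × Priv κ ℓ d → ℂ :=
  outVec C V W b ω.1.2.1 (midOracle ω.1) ω.1.1.1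
    (relTab C hC ω.1.2.2.1 ω.2 (realMsgs C z (joinKeys (wireVal C z) ω.1.1) ω.1.2.2.2) ω.1.2.2.2) x

/-- The output when, in addition, inactive rows encrypt zero. -/
noncomputable def idealVec (x : Msg N) (ω : Sample κ ℓ C) : Cipher κ ℓ C × Priv κ ℓ d → ℂ :=
  outVec C V W b ω.1.2.1 (midOracle ω.1) ω.1.1.1
    (relTab C hC ω.1.2.2.1 ω.2 (idealMsgs C ω.1.1.1 ω.1.2.2.2) ω.1.2.2.2) x

/-- The probability that the game with fixed random data ends in the event `D`, which may depend on
the keys that are inactive on input `z`. -/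
noncomputable def gameWeight (D : (Wire N L → BV κ) → Set (Cipher κ ℓ C × Priv κ ℓ d))
    (z x : Msg N) (K : Wire N L → Bit → BV κ) (H : Oracle κ ℓ) (r : TabRand κ C) : ℝ :=
  nsq ((D (fun w => K w (wireVal C z w + 1))).indicator
    (outVec C V W b H H (fun w => K w (wireVal C z w)) (tab C hC H K r) x))

variable {C} {V} {W} {b}

theorem nsq_outVec_le (hV : ∀ H, Contr (V H)) (Hw Hv : Oracle κ ℓ) (k : Wire N L → BV κ)
    (T : Tab κ ℓ C) (x : Msg N) :
    nsq (outVec C V W b Hw Hv k T x) ≤ nsq (block x (W Hw *ᵥ b)) :=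
  (hV _ _).trans (nsq_place _ _).le

theorem sum_nsq_outVec_le (hV : ∀ H, Contr (V H)) (hW : ∀ H, Contr (W H)) (Hw Hv : Oracle κ ℓ)
    (k : Msg N → Wire N L → BV κ) (T : Msg N → Tab κ ℓ C) :
    ∑ x, nsq (outVec C V W b Hw Hv (k x) (T x) x) ≤ nsq b := by
  refine (Finset.sum_le_sum fun x _ => nsq_outVec_le hV Hw Hv (k x) (T x) x).trans ?_
  rw [sum_nsq_block]; exact hW _ _

variable {hC}

/-- For distinct keys the two reprogrammings do not interfere: the full oracle has exactly the
values `F₀` at active and `F₁` at inactive keys. -/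
theorem realVec_eq_outVec (z x : Msg N) (ω : Sample κ ℓ C)
    (hk : Function.Injective (Sum.elim ω.1.1.1 ω.1.1.2)) (r : TabRand κ C)
    (hr : relabel C z r = ω.1.2.2.2) :
    outVec C V W b (fullOracle ω) (fullOracle ω) ω.1.1.1
        (tab C hC (fullOracle ω) (joinKeys (wireVal C z) ω.1.1) r) x
      = realVec C hC V W b z x ω := by
  rw [realVec, tab_eq_relTab C hC _ _ z, hr]
  have h0 : ∀ w, joinKeys (wireVal C z) ω.1.1 w (wireVal C z w) = ω.1.1.1 w := fun w =>
    congrFun (congrArg Prod.fst ((splitKeys (wireVal C z)).apply_symm_apply ω.1.1)) w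
  have h1 : ∀ w, joinKeys (wireVal C z) ω.1.1 w (wireVal C z w + 1) = ω.1.1.2 w := fun w =>
    congrFun (congrArg Prod.snd ((splitKeys (wireVal C z)).apply_symm_apply ω.1.1)) w
  have hi0 : Function.Injective ω.1.1.1 := hk.comp Sum.inl_injective
  have hi1 : Function.Injective ω.1.1.2 := hk.comp Sum.inr_injective
  have hF0 : (fun w R => fullOracle ω (ω.1.1.1 w, R)) = ω.1.2.2.1 := by
    funext w R
    rw [fullOracle, reprog_of_notMem, midOracle, reprog_apply _ hi0]
    rintro ⟨w', hw'⟩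
    exact Sum.inr_ne_inl (hk (a₁ := Sum.inr w') (a₂ := Sum.inl w) hw')
  have hF1 : (fun w R => fullOracle ω (ω.1.1.2 w, R)) = ω.2 := by
    funext w R
    rw [fullOracle, reprog_apply _ hi1]
  simp only [h0, h1, hF0, hF1]

/-- Sampling an oracle is the same as sampling its values at distinct keys separately. -/
theorem expect_game_eq (D : (Wire N L → BV κ) → Set (Cipher κ ℓ C × Priv κ ℓ d)) (z x : Msg N)
    [∀ K : Wire N L → Bit → BV κ, Decidable (Function.Injective fun p : Wire N L × Bit => K p.1 p.2)]
    [∀ ω : Sample κ ℓ C, Decidable (Function.Injective (Sum.elim ω.1.1.1 ω.1.1.2))] :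
    𝔼 K : Wire N L → Bit → BV κ, (if Function.Injective (fun p : Wire N L × Bit => K p.1 p.2) then
        𝔼 H, 𝔼 r, gameWeight C hC V W b D z x K H r else 0)
      = 𝔼 ω : Sample κ ℓ C, (if Function.Injective (Sum.elim ω.1.1.1 ω.1.1.2) then
        nsq ((D ω.1.1.2).indicator (realVec C hC V W b z x ω)) else 0) := by
  classical
  have hΩ : ∀ f : Sample κ ℓ C → ℝ, 𝔼 ω, f ω
      = 𝔼 k : (Wire N L → BV κ) × (Wire N L → BV κ), 𝔼 r : TabRand κ C, 𝔼 G : Oracle κ ℓ,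
        𝔼 F₀ : Wire N L → BV κ → BV ℓ, 𝔼 F₁ : Wire N L → BV κ → BV ℓ,
          f ((k, G, F₀, r), F₁) := by
    intro f
    rw [← Finset.univ_product_univ, Finset.expect_product, ← Finset.univ_product_univ,
      Finset.expect_product]
    refine Finset.expect_congr rfl fun k _ => ?_
    rw [← Finset.univ_product_univ, Finset.expect_product]
    conv_rhs => rw [Finset.expect_comm]
    refine Finset.expect_congr rfl fun G _ => ?_
    rw [← Finset.univ_product_univ, Finset.expect_product, Finset.expect_comm]
  rw [hΩ]
  refine Fintype.expect_equiv (splitKeys (wireVal C z)) _ _ fun K => ?_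
  by_cases hK : Function.Injective (fun p : Wire N L × Bit => K p.1 p.2)
  · have hk := (splitKeys_injective_iff (wireVal C z) K).2 hK
    have hi0 : Function.Injective (splitKeys (wireVal C z) K).1 := hk.comp Sum.inl_injective
    have hi1 : Function.Injective (splitKeys (wireVal C z) K).2 := hk.comp Sum.inr_injective
    rw [if_pos hK, Finset.expect_comm]
    simp only [if_pos hk]
    -- The table randomness is resampled in the labelling relative to `z`; then the oracle is split
    -- off twice, first at the inactive and then at the active keys.
    rw [← expect_comp_equiv (relabel C z).symm]
    refine Finset.expect_congr rfl fun r _ => ?_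
    rw [← expect_reprog hi1, ← expect_reprog hi0]
    refine Finset.expect_congr rfl fun G _ => Finset.expect_congr rfl fun F₀ _ =>
      Finset.expect_congr rfl fun F₁ _ => ?_
    rw [← realVec_eq_outVec z x ((splitKeys (wireVal C z) K, G, F₀, r), F₁) hk
      ((relabel C z).symm r) ((relabel C z).apply_symm_apply r)]
    have : joinKeys (wireVal C z) (splitKeys (wireVal C z) K) = K :=
      (splitKeys (wireVal C z)).symm_apply_apply K
    rw [gameWeight, this]
    rfl
  · have hk := (splitKeys_injective_iff (wireVal C z) K).not.2 hK
    rw [if_neg hK]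
    simp only [if_neg hk, Finset.expect_const_zero]

theorem expect_sample_eq (f : Sample κ ℓ C → ℝ) :
    𝔼 ω, f ω = 𝔼 θ : Seed κ ℓ C, 𝔼 F₁ : Wire N L → BV κ → BV ℓ, f (θ, F₁) := by
  rw [← Finset.univ_product_univ, Finset.expect_product]

theorem expect_seed_keys (f : (Wire N L → BV κ) × (Wire N L → BV κ) → ℝ) [Nonempty (TabRand κ C)] :
    𝔼 θ : Seed κ ℓ C, f θ.1 = 𝔼 k, f k := by
  rw [← Finset.univ_product_univ, Finset.expect_product]
  simp only [Fintype.expect_const]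

theorem expect_seed_rand (f : TabRand κ C → ℝ) :
    𝔼 θ : Seed κ ℓ C, f θ.2.2.2 = 𝔼 r, f r := by
  rw [← Finset.univ_product_univ, Finset.expect_product]
  simp only [Fintype.expect_const]
  rw [← Finset.univ_product_univ, Finset.expect_product]
  simp only [Fintype.expect_const]
  rw [← Finset.univ_product_univ, Finset.expect_product]
  simp only [Fintype.expect_const]

theorem card_wire : Fintype.card (Wire N L) = N + 3 * L := by
  simp [Wire, mul_comm]

theorem card_bv (n : ℕ) : (Fintype.card (BV n) : ℝ) = 2 ^ n := by simp [ZMod.card]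

theorem expect_not_injective_pair_le
    [∀ k : (Wire N L → BV κ) × (Wire N L → BV κ), Decidable (Function.Injective (Sum.elim k.1 k.2))] :
    𝔼 k : (Wire N L → BV κ) × (Wire N L → BV κ),
      (if Function.Injective (Sum.elim k.1 k.2) then (0 : ℝ) else 1)
      ≤ (2 * (N + 3 * L)) ^ 2 / 2 ^ κ := by
  let e : Wire N L ⊕ Wire N L → BV κ →
      ((Wire N L → BV κ) × (Wire N L → BV κ)) ≃ ((Wire N L → BV κ) × (Wire N L → BV κ)) :=
    fun i c => Sum.elim
      (fun w => Equiv.prodCongr (Equiv.addRight (Pi.single w c)) (Equiv.refl _))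
      (fun w => Equiv.prodCongr (Equiv.refl _) (Equiv.addRight (Pi.single w c))) i
  refine (expect_not_injective_le e (fun k => Sum.elim k.1 k.2) fun i c k j => ?_).trans ?_
  · rcases i with w | w <;> rcases j with w' | w' <;> simp [e, Pi.single_apply]
  · rw [card_bv, Fintype.card_sum, card_wire]
    push_cast
    rw [two_mul]

/-- The event is symmetric in the keys, so any choice of active bits will do; here it is `0`. -/
theorem expect_not_injective_keys_eq
    [∀ K : Wire N L → Bit → BV κ, Decidable (Function.Injective fun p : Wire N L × Bit => K p.1 p.2)]
    [∀ k : (Wire N L → BV κ) × (Wire N L → BV κ), Decidable (Function.Injective (Sum.elim k.1 k.2))] :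
    𝔼 K : Wire N L → Bit → BV κ,
      (if Function.Injective (fun p : Wire N L × Bit => K p.1 p.2) then (0 : ℝ) else 1)
      = 𝔼 k : (Wire N L → BV κ) × (Wire N L → BV κ),
      (if Function.Injective (Sum.elim k.1 k.2) then (0 : ℝ) else 1) := by
  refine Fintype.expect_equiv (splitKeys 0) _ _ fun K => ?_
  simp only [splitKeys_injective_iff]

end Core

/-! ### Error bounds for the game hops. -/

section Estimates

variable {κ ℓ N L d : ℕ} {C : Circuit N L} {hC : C.Fits κ ℓ}
  {V : Oracle κ ℓ → Matrix (Cipher κ ℓ C × Priv κ ℓ d) (Cipher κ ℓ C × Priv κ ℓ d) ℂ}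
  {W : Oracle κ ℓ → Matrix (Msg N × Priv κ ℓ d) (Msg N × Priv κ ℓ d) ℂ}
  {b : Msg N × Priv κ ℓ d → ℂ}

theorem nonempty_gateRand (κ : ℕ) (g : Gate N) : Nonempty (GateRand κ g) := by
  cases g with
  | toffoli p =>
    exact ⟨((Equiv.refl _, fun _ => (fun _ => 0, fun _ => 0)),
      (Equiv.refl _, fun _ => (fun _ => 0, fun _ => 0)))⟩
  | phase w n => exact ⟨((0 : ZMod n), Equiv.refl _, fun _ => (fun _ => 0, fun _ => 0))⟩

instance : Nonempty (TabRand κ C) :=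
  have := fun t => nonempty_gateRand κ (C t)
  inferInstance

/-- Probability bound for coinciding keys. -/
noncomputable def keyColl (κ N L : ℕ) : ℝ := (2 * (N + 3 * L)) ^ 2 / 2 ^ κ

/-- Probability bound for coinciding paddings. -/
noncomputable def padColl (κ L : ℕ) : ℝ := (96 * L) ^ 2 / 2 ^ κ

/-- Probability bound for guessing one of the inactive keys. -/
noncomputable def guessProb (κ N L : ℕ) : ℝ := (N + 3 * L) / 2 ^ κ

/-- The messages of inactive rows are hidden from whoever does not know the oracle values at inactive
keys. -/
theorem abs_expect_relTab_sub_le {B : ℝ} (φ : Msg N → Seed κ ℓ C → Tab κ ℓ C → ℝ)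
    (hφ : ∀ x θ T, 0 ≤ φ x θ T) (hB : ∀ θ (T : Msg N → Tab κ ℓ C), ∑ x, φ x θ (T x) ≤ B)
    (M : Msg N → Seed κ ℓ C → TabMsgs κ C)
    (hM : ∀ x θ t, AgreeActive (C t) (M x θ t) (idealMsgs C θ.1.1 θ.2.2.2 t)) :
    |(𝔼 ω : Sample κ ℓ C, ∑ x, φ x ω.1 (relTab C hC ω.1.2.2.1 ω.2 (M x ω.1) ω.1.2.2.2))
      - 𝔼 ω : Sample κ ℓ C, ∑ x, φ x ω.1
          (relTab C hC ω.1.2.2.1 ω.2 (idealMsgs C ω.1.1.1 ω.1.2.2.2) ω.1.2.2.2)|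
      ≤ B * padColl κ L := by
  classical
  have hB0 : 0 ≤ B := by
    have θ : Seed κ ℓ C := ((0, 0), 0, 0, Classical.arbitrary _)
    exact (Finset.sum_nonneg fun x _ => hφ x θ _).trans
      (hB θ fun x => relTab C hC 0 0 (M x θ) θ.2.2.2)
  rw [expect_sample_eq, expect_sample_eq, ← Finset.expect_sub_distrib]
  have h1 : ∀ θ : Seed κ ℓ C,
      |(𝔼 F₁ : Wire N L → BV κ → BV ℓ, ∑ x, φ x θ (relTab C hC θ.2.2.1 F₁ (M x θ) θ.2.2.2))
      - 𝔼 F₁ : Wire N L → BV κ → BV ℓ, ∑ x, φ x θ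
          (relTab C hC θ.2.2.1 F₁ (idealMsgs C θ.1.1 θ.2.2.2) θ.2.2.2)|
      ≤ B * if Function.Injective (pads C θ.2.2.2) then 0 else 1 := by
    intro θ
    -- Distinct paddings hide the messages perfectly. Otherwise both averages lie in `[0, B]`.
    split_ifs with h
    · rw [Finset.expect_sum_comm, Finset.expect_sum_comm]
      rw [Finset.sum_congr rfl fun x _ => expect_relTab_congr C hC θ.2.2.1 (M x θ)
        (idealMsgs C θ.1.1 θ.2.2.2) θ.2.2.2 h (hM x θ) (φ x θ)]
      simp
    · rw [mul_one]
      refine abs_sub_le_of_nonneg_of_le ?_ ?_ ?_ ?_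
      · exact expect_nonneg' fun F₁ => Finset.sum_nonneg fun x _ => hφ _ _ _
      · exact expect_le_of_forall_le fun F₁ => hB θ _
      · exact expect_nonneg' fun F₁ => Finset.sum_nonneg fun x _ => hφ _ _ _
      · exact expect_le_of_forall_le fun F₁ => hB θ fun _ => _
  refine (Finset.abs_expect_le _ _).trans ((expect_mono h1).trans ?_)
  rw [← Finset.mul_expect]
  refine mul_le_mul_of_nonneg_left ?_ hB0
  rw [expect_seed_rand (fun r => if Function.Injective (pads C r) then (0 : ℝ) else 1)]
  exact expect_not_injective_pads_le C

/-- Translation of active and inactive keys. -/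
def shiftKeys (c c' : BV κ) : Sample κ ℓ C ≃ Sample κ ℓ C :=
  Equiv.prodCongr (Equiv.prodCongr
    (Equiv.prodCongr (Equiv.addRight fun _ => c) (Equiv.addRight fun _ => c'))
    (Equiv.refl _)) (Equiv.refl _)

theorem shiftKeys_apply (c c' : BV κ) (ω : Sample κ ℓ C) :
    shiftKeys c c' ω
      = (((fun w => ω.1.1.1 w + c, fun w => ω.1.1.2 w + c'), ω.1.2), ω.2) := rfl

/-- A state invariant under translation of the inactive keys is independent of each single one of
them. A common translation of all wires is enough because the union bound treats the keys one at a
time. -/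
theorem expect_hit_le {X : Type*} [Fintype X] {J : Type*} [Fintype J] (g : J → Wire N L)
    (key : J → X → BV κ) (ψ : Sample κ ℓ C → X → ℂ) (hψ : ∀ c ω, ψ (shiftKeys 0 c ω) = ψ ω) :
    𝔼 ω : Sample κ ℓ C, nsq ({x | ∃ j, key j x = ω.1.1.2 (g j)}.indicator (ψ ω))
      ≤ Fintype.card J / 2 ^ κ * 𝔼 ω, nsq (ψ ω) := by
  rw [← card_bv κ]
  exact expect_nsq_indicator_exists_le (fun c => shiftKeys 0 c) (fun ω j => ω.1.1.2 (g j)) key ψ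
    (fun c ω j => rfl) hψ

theorem expect_hit_active_le {X : Type*} [Fintype X]
    (key : X → BV κ) (ψ : Sample κ ℓ C → X → ℂ) (hψ : ∀ c ω, ψ (shiftKeys c 0 ω) = ψ ω) :
    𝔼 ω : Sample κ ℓ C, nsq ({x | ∃ w, key x = ω.1.1.1 w}.indicator (ψ ω))
      ≤ guessProb κ N L * 𝔼 ω, nsq (ψ ω) := by
  have h := expect_nsq_indicator_exists_le (fun c => shiftKeys (C := C) (ℓ := ℓ) c 0)
    (fun ω j => ω.1.1.1 j) (fun _ => key) ψ (fun c ω j => rfl) hψ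
  rw [card_bv κ, card_wire] at h
  unfold guessProb
  push_cast at h
  exact h

theorem expect_hit_inactive_le {X : Type*} [Fintype X]
    (key : X → BV κ) (ψ : Sample κ ℓ C → X → ℂ) (hψ : ∀ c ω, ψ (shiftKeys 0 c ω) = ψ ω) :
    𝔼 ω : Sample κ ℓ C, nsq ({x | ∃ w, key x = ω.1.1.2 w}.indicator (ψ ω))
      ≤ guessProb κ N L * 𝔼 ω, nsq (ψ ω) := by
  have h := expect_hit_le (C := C) (ℓ := ℓ) (fun w : Wire N L => w) (fun _ => key) ψ hψ
  rw [card_wire] at h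
  unfold guessProb
  push_cast at h
  exact h

theorem guessProb_nonneg (κ N L : ℕ) : 0 ≤ guessProb κ N L := by unfold guessProb; positivity

theorem range_eq_setOf_exists {α β : Type*} (f : α → β) : Set.range f = {y | ∃ w, y = f w} := by
  ext y; simp [eq_comm]

/-- In the first phase, keys are queried with small weight. -/
theorem expect_hit_first_le
    {P : Oracle κ ℓ → Matrix (Msg N × Priv κ ℓ d) (Msg N × Priv κ ℓ d) ℂ}
    (hP : ∀ G, Contr (P G)) (b : Msg N × Priv κ ℓ d → ℂ) :
    𝔼 ω : Sample κ ℓ C, nsq ((queryKeyIn (Msg N) ℓ d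
      (Set.range ω.1.1.1 ∪ Set.range ω.1.1.2)).indicator (P ω.1.2.1 *ᵥ b))
      ≤ 2 * guessProb κ N L * nsq b := by
  have h0 := expect_hit_active_le (C := C) (ℓ := ℓ)
    (fun z : Msg N × Priv κ ℓ d => z.2.1.1) (fun ω => P ω.1.2.1 *ᵥ b) (fun _ _ => rfl)
  have h1 := expect_hit_inactive_le (C := C) (ℓ := ℓ)
    (fun z : Msg N × Priv κ ℓ d => z.2.1.1) (fun ω => P ω.1.2.1 *ᵥ b) (fun _ _ => rfl)
  have h2 : 𝔼 ω : Sample κ ℓ C, nsq (P ω.1.2.1 *ᵥ b) ≤ nsq b :=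
    expect_le_of_forall_le fun ω => hP _ _
  have h3 : 𝔼 ω : Sample κ ℓ C, nsq ((queryKeyIn (Msg N) ℓ d
      (Set.range ω.1.1.1 ∪ Set.range ω.1.1.2)).indicator (P ω.1.2.1 *ᵥ b))
      ≤ 𝔼 ω : Sample κ ℓ C,
        (nsq ({z : Msg N × Priv κ ℓ d | ∃ w, z.2.1.1 = ω.1.1.1 w}.indicator (P ω.1.2.1 *ᵥ b))
        + nsq ({z : Msg N × Priv κ ℓ d | ∃ w, z.2.1.1 = ω.1.1.2 w}.indicator (P ω.1.2.1 *ᵥ b))) := by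
    refine expect_mono fun ω => ?_
    rw [range_eq_setOf_exists, range_eq_setOf_exists]
    exact nsq_indicator_union_le _ _ _
  rw [Finset.expect_add_distrib] at h3
  have h4 := mul_le_mul_of_nonneg_left h2 (guessProb_nonneg κ N L)
  linarith

theorem agreeActive_joinKeys (z : Msg N) (θ : Seed κ ℓ C) (t : Fin L) :
    AgreeActive (C t) (realMsgs C z (joinKeys (wireVal C z) θ.1) θ.2.2.2 t)
      (idealMsgs C θ.1.1 θ.2.2.2 t) := by
  have h := agreeActive_realMsgs C (joinKeys (wireVal C z) θ.1) z θ.2.2.2 t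
  have h0 : (fun w => joinKeys (wireVal C z) θ.1 w (wireVal C z w)) = θ.1.1 := by
    funext w; simp [joinKeys]
  rwa [h0] at h

/-- Averages over the intermediate and the ideal game are close. -/
theorem abs_expect_midVec_sub_le (hV : ∀ H, Contr (V H)) (hW : ∀ H, Contr (W H))
    (D : (Wire N L → BV κ) → Set (Cipher κ ℓ C × Priv κ ℓ d)) (z : Msg N → Msg N) :
    |(𝔼 ω : Sample κ ℓ C, ∑ x, nsq ((D ω.1.1.2).indicator (midVec C hC V W b (z x) x ω)))
      - 𝔼 ω : Sample κ ℓ C, ∑ x, nsq ((D ω.1.1.2).indicator (idealVec C hC V W b x ω))|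
      ≤ nsq b * padColl κ L :=
  abs_expect_relTab_sub_le (hC := hC)
    (fun x θ T => nsq ((D θ.1.2).indicator (outVec C V W b θ.2.1 (midOracle θ) θ.1.1 T x)))
    (fun _ _ _ => nsq_nonneg _)
    (fun _ _ => (Finset.sum_le_sum fun _ _ => nsq_indicator_le _ _).trans
      (sum_nsq_outVec_le hV hW _ _ _ _))
    (fun x θ => realMsgs C (z x) (joinKeys (wireVal C (z x)) θ.1) θ.2.2.2)
    (fun x θ t => agreeActive_joinKeys (z x) θ t)

/-- In the ideal game, the inactive keys are independent of everything. -/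
theorem expect_idealVec_hit_le (hV : ∀ H, Contr (V H)) (hW : ∀ H, Contr (W H))
    {J : Type*} [Fintype J] (g : J → Wire N L) (key : J → Cipher κ ℓ C × Priv κ ℓ d → BV κ) :
    𝔼 ω : Sample κ ℓ C, ∑ x, nsq ({y | ∃ j, key j y = ω.1.1.2 (g j)}.indicator
        (idealVec C hC V W b x ω))
      ≤ Fintype.card J / 2 ^ κ * nsq b := by
  rw [Finset.expect_sum_comm]
  refine (Finset.sum_le_sum fun x _ =>
    expect_hit_le g key (idealVec C hC V W b x) fun _ _ => ?_).trans ?_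
  -- No inactive key occurs here: the oracle is reprogrammed at active keys only, and inactive rows
  -- encrypt zero.
  · simp only [idealVec, shiftKeys_apply, add_zero, midOracle]
  · rw [← Finset.mul_sum, ← Finset.expect_sum_comm]
    refine mul_le_mul_of_nonneg_left ?_ (by positivity)
    exact expect_le_of_forall_le fun ω => sum_nsq_outVec_le hV hW _ _ (fun _ => _) (fun _ => _)

/-- In the second phase of the intermediate game, inactive keys are queried with small weight. -/
theorem expect_hit_second_le
    {P : Oracle κ ℓ → Matrix (Cipher κ ℓ C × Priv κ ℓ d) (Cipher κ ℓ C × Priv κ ℓ d) ℂ}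
    (hP : ∀ G, Contr (P G)) (hW : ∀ H, Contr (W H)) (z : Msg N → Msg N) :
    𝔼 ω : Sample κ ℓ C, ∑ x, nsq ((queryKeyIn (Cipher κ ℓ C) ℓ d
      (Set.range ω.1.1.2)).indicator (midVec C hC P W b (z x) x ω))
      ≤ (guessProb κ N L + padColl κ L) * nsq b := by
  -- The state before a query is treated as the final state of a game, with the prefix `P` as second
  -- phase. This hop needs no bound on queries, so there is no circularity.
  have h1 := abs_expect_midVec_sub_le (hC := hC) (b := b) hP hW
    (fun K₁ => queryKeyIn (Cipher κ ℓ C) ℓ d (Set.range K₁)) z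
  have h2 := expect_idealVec_hit_le (hC := hC) (b := b) hP hW (fun w : Wire N L => w)
    (fun _ y => y.2.1.1)
  rw [card_wire] at h2
  push_cast at h2
  simp only [queryKeyIn, range_eq_setOf_exists] at h1 ⊢
  have h3 := (abs_le.1 h1).2
  unfold guessProb
  simp only [Set.mem_ofPred_eq] at h3 ⊢
  linarith

/-- The bound on the effect of reprogramming, for `m` queries in the first and `n` queries in the
second phase. -/
noncomputable def reprogErr (κ N L m n : ℕ) : ℝ :=
  2 * (m * (m * (4 * (2 * guessProb κ N L))))
    + 2 * (n * (n * (4 * (guessProb κ N L + padColl κ L))))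

theorem fullOracle_eq_midOracle (ω : Sample κ ℓ C) (p : BV κ × BV κ)
    (hp : p.1 ∉ Set.range ω.1.1.2) : fullOracle ω p = midOracle ω.1 p :=
  reprog_of_notMem _ _ hp

theorem fullOracle_eq (ω : Sample κ ℓ C) (p : BV κ × BV κ)
    (hp : p.1 ∉ Set.range ω.1.1.1 ∪ Set.range ω.1.1.2) : fullOracle ω p = ω.1.2.1 p := by
  rw [Set.mem_union, not_or] at hp
  rw [fullOracle_eq_midOracle ω p hp.2]
  exact reprog_of_notMem _ _ hp.1

/-- The first phase is independent of all keys and may use the base oracle. The second phase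
receives active keys, so only the values at inactive keys are withheld from it. Both hybrids are
evaluated on runs with the weaker oracle, for which the hitting weights are known. -/
theorem expect_nsq_realVec_sub_midVec_le {m n : ℕ} (hV : IsQueryAlg n V) (hW : IsQueryAlg m W)
    (z : Msg N → Msg N) :
    𝔼 ω : Sample κ ℓ C, ∑ x, nsq (realVec C hC V W b (z x) x ω - midVec C hC V W b (z x) x ω)
      ≤ reprogErr κ N L m n * nsq b := by
  obtain ⟨hVc, P, hP, hVd⟩ := hV
  obtain ⟨hWc, R, hR, hWd⟩ := hW
  have hpt : ∀ ω : Sample κ ℓ C,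
      ∑ x, nsq (realVec C hC V W b (z x) x ω - midVec C hC V W b (z x) x ω)
      ≤ 2 * (m * ∑ i ∈ Finset.range m, 4 * nsq ((queryKeyIn (Msg N) ℓ d
          (Set.range ω.1.1.1 ∪ Set.range ω.1.1.2)).indicator (R i ω.1.2.1 *ᵥ b)))
        + 2 * (n * ∑ i ∈ Finset.range n, 4 * ∑ x, nsq ((queryKeyIn (Cipher κ ℓ C) ℓ d
          (Set.range ω.1.1.2)).indicator (midVec C hC (P i) W b (z x) x ω))) := by
    intro ω
    have h1 := hWd (fullOracle ω) ω.1.2.1 _ (fullOracle_eq ω) b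
    have h2 : ∀ x, nsq (realVec C hC V W b (z x) x ω - midVec C hC V W b (z x) x ω)
        ≤ 2 * nsq (block x (W (fullOracle ω) *ᵥ b - W ω.1.2.1 *ᵥ b))
          + 2 * (n * ∑ i ∈ Finset.range n, 4 * nsq ((queryKeyIn (Cipher κ ℓ C) ℓ d
          (Set.range ω.1.1.2)).indicator (midVec C hC (P i) W b (z x) x ω))) := by
      intro x
      unfold realVec midVec outVec
      set c : Cipher κ ℓ C := ((fun i => ω.1.1.1 (Sum.inl i),
        relTab C hC ω.1.2.2.1 ω.2 (realMsgs C (z x) (joinKeys (wireVal C (z x)) ω.1.1) ω.1.2.2.2)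
          ω.1.2.2.2) : Cipher κ ℓ C)
      -- The first phase is replaced before the second, so that the second error concerns the state
      -- prepared with the base oracle.
      have hdec : V (fullOracle ω) *ᵥ place c (block x (W (fullOracle ω) *ᵥ b))
          - V (midOracle ω.1) *ᵥ place c (block x (W ω.1.2.1 *ᵥ b))
          = V (fullOracle ω) *ᵥ place c (block x (W (fullOracle ω) *ᵥ b - W ω.1.2.1 *ᵥ b))
            + (V (fullOracle ω) *ᵥ place c (block x (W ω.1.2.1 *ᵥ b))
              - V (midOracle ω.1) *ᵥ place c (block x (W ω.1.2.1 *ᵥ b))) := by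
        rw [block_sub, place_sub, Matrix.mulVec_sub]; abel
      rw [hdec]
      refine (nsq_add_le _ _).trans ?_
      have e1 := (hVc (fullOracle ω)
        (place c (block x (W (fullOracle ω) *ᵥ b - W ω.1.2.1 *ᵥ b)))).trans (nsq_place _ _).le
      have e2 := hVd (fullOracle ω) (midOracle ω.1) _ (fullOracle_eq_midOracle ω)
        (place c (block x (W ω.1.2.1 *ᵥ b)))
      linarith
    refine (Finset.sum_le_sum fun x _ => h2 x).trans ?_
    rw [Finset.sum_add_distrib, ← Finset.mul_sum, ← Finset.mul_sum, sum_nsq_block,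
      ← Finset.mul_sum, Finset.sum_comm]
    simp only [← Finset.mul_sum] at h1 ⊢
    linarith
  refine (expect_mono hpt).trans ?_
  rw [Finset.expect_add_distrib]
  simp only [← Finset.mul_expect, Finset.expect_sum_comm Finset.univ (Finset.range _)]
  have h1 : ∑ i ∈ Finset.range m, 4 * 𝔼 ω : Sample κ ℓ C, nsq ((queryKeyIn (Msg N) ℓ d
        (Set.range ω.1.1.1 ∪ Set.range ω.1.1.2)).indicator (R i ω.1.2.1 *ᵥ b))
      ≤ m * (4 * (2 * guessProb κ N L * nsq b)) := by
    refine (Finset.sum_le_card_nsmul _ _ (4 * (2 * guessProb κ N L * nsq b)) fun i _ => ?_).trans ?_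
    · exact mul_le_mul_of_nonneg_left (expect_hit_first_le (hR i) b) (by norm_num)
    · simp
  have h2 : ∑ i ∈ Finset.range n, 4 * 𝔼 ω : Sample κ ℓ C, ∑ x, nsq ((queryKeyIn (Cipher κ ℓ C) ℓ d
        (Set.range ω.1.1.2)).indicator (midVec C hC (P i) W b (z x) x ω))
      ≤ n * (4 * ((guessProb κ N L + padColl κ L) * nsq b)) := by
    refine (Finset.sum_le_card_nsmul _ _ (4 * ((guessProb κ N L + padColl κ L) * nsq b))
      fun i _ => ?_).trans ?_
    · exact mul_le_mul_of_nonneg_left (expect_hit_second_le (hP i) hWc z) (by norm_num)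
    · simp
  calc _ ≤ 2 * (m * (m * (4 * (2 * guessProb κ N L * nsq b))))
        + 2 * (n * (n * (4 * ((guessProb κ N L + padColl κ L) * nsq b)))) := by gcongr
    _ = _ := by unfold reprogErr; ring

/-- The distance between the game and the ideal game. -/
noncomputable def gameErr (κ N L m n : ℕ) (s : ℝ) : ℝ :=
  2 * keyColl κ N L + padColl κ L + s⁻¹ * reprogErr κ N L m n + 2 * s

/-- Closeness in mean square becomes closeness of probabilities through `abs_nsq_sub_le`; the term
`2 * s` comes from the two total weights, each at most `nsq b`. -/
theorem abs_expect_realVec_sub_midVec_le {m n : ℕ} (hV : IsQueryAlg n V) (hW : IsQueryAlg m W)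
    (D : (Wire N L → BV κ) → Set (Cipher κ ℓ C × Priv κ ℓ d)) (z : Msg N → Msg N) {s : ℝ}
    (hs : 0 < s) :
    |(𝔼 ω : Sample κ ℓ C, ∑ x, nsq ((D ω.1.1.2).indicator (realVec C hC V W b (z x) x ω)))
      - 𝔼 ω : Sample κ ℓ C, ∑ x, nsq ((D ω.1.1.2).indicator (midVec C hC V W b (z x) x ω))|
      ≤ (s⁻¹ * reprogErr κ N L m n + 2 * s) * nsq b := by
  rw [← Finset.expect_sub_distrib]
  refine (Finset.abs_expect_le _ _).trans ?_
  have hpt : ∀ ω : Sample κ ℓ C,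
      |∑ x, nsq ((D ω.1.1.2).indicator (realVec C hC V W b (z x) x ω))
        - ∑ x, nsq ((D ω.1.1.2).indicator (midVec C hC V W b (z x) x ω))|
      ≤ s⁻¹ * ∑ x, nsq (realVec C hC V W b (z x) x ω - midVec C hC V W b (z x) x ω)
        + s * (2 * nsq b) := by
    intro ω
    rw [← Finset.sum_sub_distrib]
    refine (Finset.abs_sum_le_sum_abs _ _).trans
      ((Finset.sum_le_sum fun x _ => abs_nsq_sub_le _ _ hs).trans ?_)
    rw [Finset.sum_add_distrib, ← Finset.mul_sum, ← Finset.mul_sum, Finset.sum_add_distrib]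
    have e1 : ∑ x, nsq ((D ω.1.1.2).indicator (realVec C hC V W b (z x) x ω)) ≤ nsq b :=
      (Finset.sum_le_sum fun x _ => nsq_indicator_le _ _).trans
        (sum_nsq_outVec_le hV.1 hW.1 _ _ (fun _ => _) _)
    have e2 : ∑ x, nsq ((D ω.1.1.2).indicator (midVec C hC V W b (z x) x ω)) ≤ nsq b :=
      (Finset.sum_le_sum fun x _ => nsq_indicator_le _ _).trans
        (sum_nsq_outVec_le hV.1 hW.1 _ _ (fun _ => _) _)
    have e3 : ∑ x, nsq ((D ω.1.1.2).indicator (realVec C hC V W b (z x) x ω)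
        - (D ω.1.1.2).indicator (midVec C hC V W b (z x) x ω))
        ≤ ∑ x, nsq (realVec C hC V W b (z x) x ω - midVec C hC V W b (z x) x ω) := by
      refine Finset.sum_le_sum fun x _ => ?_
      rw [← Set.indicator_sub']
      exact nsq_indicator_le _ _
    have e4 := mul_le_mul_of_nonneg_left e3 (inv_pos.2 hs).le
    have e5 := mul_le_mul_of_nonneg_left (add_le_add e1 e2) hs.le
    linarith
  refine (expect_mono hpt).trans ?_
  rw [Finset.expect_add_distrib, Fintype.expect_const, ← Finset.mul_expect]
  have h := mul_le_mul_of_nonneg_left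
    (expect_nsq_realVec_sub_midVec_le (hC := hC) (b := b) hV hW z) (inv_pos.2 hs).le
  linarith

theorem sum_gameWeight_nonneg (D : (Wire N L → BV κ) → Set (Cipher κ ℓ C × Priv κ ℓ d))
    (z : Msg N → Msg N) (K : Wire N L → Bit → BV κ) (H : Oracle κ ℓ) (r : TabRand κ C) :
    0 ≤ ∑ x, gameWeight C hC V W b D (z x) x K H r :=
  Finset.sum_nonneg fun _ _ => nsq_nonneg _

theorem sum_gameWeight_le (hV : ∀ H, Contr (V H)) (hW : ∀ H, Contr (W H))
    (D : (Wire N L → BV κ) → Set (Cipher κ ℓ C × Priv κ ℓ d))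
    (z : Msg N → Msg N) (K : Wire N L → Bit → BV κ) (H : Oracle κ ℓ) (r : TabRand κ C) :
    ∑ x, gameWeight C hC V W b D (z x) x K H r ≤ nsq b :=
  (Finset.sum_le_sum fun _ _ => nsq_indicator_le _ _).trans
    (sum_nsq_outVec_le hV hW _ _ (fun _ => _) _)

/-- The game, in which `x` is encrypted as `z x`, is close to the ideal game, which does not depend
on `z`. -/
theorem abs_expect_game_sub_le [Nonempty (KeySet κ N L)] {m n : ℕ} (hV : IsQueryAlg n V)
    (hW : IsQueryAlg m W)
    (D : (Wire N L → BV κ) → Set (Cipher κ ℓ C × Priv κ ℓ d)) (z : Msg N → Msg N) {s : ℝ}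
    (hs : 0 < s) :
    |(𝔼 K : KeySet κ N L, 𝔼 H, 𝔼 r, ∑ x, gameWeight C hC V W b D (z x) x K.1 H r)
      - 𝔼 ω : Sample κ ℓ C, ∑ x, nsq ((D ω.1.1.2).indicator (idealVec C hC V W b x ω))|
      ≤ gameErr κ N L m n s * nsq b := by
  classical
  set f : (Wire N L → Bit → BV κ) → ℝ := fun K =>
    𝔼 H, 𝔼 r, ∑ x, gameWeight C hC V W b D (z x) x K H r with hf
  have hf0 : ∀ K, 0 ≤ f K := fun K => expect_nonneg' fun H => expect_nonneg' fun r =>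
    sum_gameWeight_nonneg D z K H r
  have hfB : ∀ K, f K ≤ nsq b := fun K => expect_le_of_forall_le fun H =>
    expect_le_of_forall_le fun r => sum_gameWeight_le hV.1 hW.1 D z K H r
  have hkey : 𝔼 k : (Wire N L → BV κ) × (Wire N L → BV κ),
      (if Function.Injective (Sum.elim k.1 k.2) then (0 : ℝ) else 1) ≤ keyColl κ N L :=
    expect_not_injective_pair_le
  -- Valid key sets are distinct on each wire only. They are compared with uniform keys restricted
  -- to the event that all keys are distinct.
  have h1 := expect_subtype_sub_le (p := fun K : Wire N L → Bit → BV κ => ∀ w, K w 0 ≠ K w 1)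
    (fun K => Function.Injective fun p : Wire N L × Bit => K p.1 p.2)
    (fun K hK w hw => by
      have := @hK (w, 0) (w, 1) hw
      simp at this) f (nsq b) hf0 hfB
  rw [expect_not_injective_keys_eq] at h1
  have h2 : 𝔼 K : Wire N L → Bit → BV κ,
      (if Function.Injective (fun p : Wire N L × Bit => K p.1 p.2) then f K else 0)
      = 𝔼 ω : Sample κ ℓ C, (if Function.Injective (Sum.elim ω.1.1.1 ω.1.1.2) then
        ∑ x, nsq ((D ω.1.1.2).indicator (realVec C hC V W b (z x) x ω)) else 0) := by
    have e1 : ∀ K : Wire N L → Bit → BV κ,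
        (if Function.Injective (fun p : Wire N L × Bit => K p.1 p.2) then f K else 0)
        = ∑ x, if Function.Injective (fun p : Wire N L × Bit => K p.1 p.2) then
          𝔼 H, 𝔼 r, gameWeight C hC V W b D (z x) x K H r else 0 := by
      intro K
      split_ifs
      · simp only [hf, Finset.expect_sum_comm Finset.univ Finset.univ]
      · simp
    have e2 : ∀ ω : Sample κ ℓ C, (if Function.Injective (Sum.elim ω.1.1.1 ω.1.1.2) then
        ∑ x, nsq ((D ω.1.1.2).indicator (realVec C hC V W b (z x) x ω)) else 0)
        = ∑ x, if Function.Injective (Sum.elim ω.1.1.1 ω.1.1.2) then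
          nsq ((D ω.1.1.2).indicator (realVec C hC V W b (z x) x ω)) else 0 := by
      intro ω
      split_ifs
      · rfl
      · simp
    simp only [e1, e2]
    rw [Finset.expect_sum_comm, Finset.expect_sum_comm]
    exact Finset.sum_congr rfl fun x _ => expect_game_eq D (z x) x
  -- The restriction is dropped again, at the cost of a second collision term, because the later
  -- hops need independent uniform keys.
  have h3 : |(𝔼 ω : Sample κ ℓ C, (if Function.Injective (Sum.elim ω.1.1.1 ω.1.1.2) then
        ∑ x, nsq ((D ω.1.1.2).indicator (realVec C hC V W b (z x) x ω)) else 0))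
      - 𝔼 ω : Sample κ ℓ C, ∑ x, nsq ((D ω.1.1.2).indicator (realVec C hC V W b (z x) x ω))|
      ≤ nsq b * keyColl κ N L := by
    rw [← Finset.expect_sub_distrib]
    refine (Finset.abs_expect_le _ _).trans ?_
    have hpt : ∀ ω : Sample κ ℓ C, |(if Function.Injective (Sum.elim ω.1.1.1 ω.1.1.2) then
        ∑ x, nsq ((D ω.1.1.2).indicator (realVec C hC V W b (z x) x ω)) else 0)
        - ∑ x, nsq ((D ω.1.1.2).indicator (realVec C hC V W b (z x) x ω))|
        ≤ nsq b * if Function.Injective (Sum.elim ω.1.1.1 ω.1.1.2) then (0 : ℝ) else 1 := by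
      intro ω
      split_ifs
      · simp
      · rw [zero_sub, abs_neg, abs_of_nonneg (Finset.sum_nonneg fun x _ => nsq_nonneg _), mul_one]
        exact (Finset.sum_le_sum fun _ _ => nsq_indicator_le _ _).trans
          (sum_nsq_outVec_le hV.1 hW.1 _ _ (fun _ => _) _)
    refine (expect_mono hpt).trans ?_
    rw [← Finset.mul_expect, expect_sample_eq]
    refine mul_le_mul_of_nonneg_left (le_trans (le_of_eq ?_) hkey) (nsq_nonneg b)
    rw [← expect_seed_keys (C := C) (ℓ := ℓ) (fun k =>
      if Function.Injective (Sum.elim k.1 k.2) then (0 : ℝ) else 1)]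
    exact Finset.expect_congr rfl fun θ _ => Fintype.expect_const
      (if Function.Injective (Sum.elim θ.1.1 θ.1.2) then (0 : ℝ) else 1)
  have h4 := abs_expect_realVec_sub_midVec_le (hC := hC) (b := b) hV hW D z hs
  have h5 := abs_expect_midVec_sub_le (hC := hC) (b := b) hV.1 hW.1 D z
  have h1' := h1.trans (mul_le_mul_of_nonneg_left hkey (nsq_nonneg b))
  rw [h2] at h1'
  rw [abs_le] at *
  unfold gameErr
  constructor <;> linarith [h1'.1, h1'.2, h3.1, h3.2, h4.1, h4.2, h5.1, h5.2]

end Estimates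

/-! ### Block expansion of the acceptance probability. -/

section Expansion

variable {κ ℓ N L d : ℕ} {C : Circuit N L}

/-- The ciphertext of the basis state `x`. -/
def ctext (hC : C.Fits κ ℓ) (H : Oracle κ ℓ) (K : Wire N L → Bit → BV κ) (r : TabRand κ C)
    (x : Msg N) : Cipher κ ℓ C := (fun i => K (Sum.inl i) (x i), tab C hC H K r)

theorem mulVec_place {A P Y : Type*} [Fintype A] [Fintype P] [DecidableEq A]
    (M : Matrix Y (A × P) ℂ) (c : A) (u : P → ℂ) (y : Y) :
    (M *ᵥ place c u) y = ∑ a, M y (c, a) * u a := by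
  simp only [Matrix.mulVec, dotProduct, place]
  rw [Fintype.sum_prod_type, Finset.sum_eq_single c]
  · simp
  · intro a _ ha; simp [ha]
  · simp

/-- The contribution of the block `(x, y)` of a state to the weight of the basis vector `w`, when `x`
is encrypted as `c` and `y` as `c'`. -/
noncomputable def blockTerm
    (M : Matrix (Cipher κ ℓ C × Priv κ ℓ d) (Cipher κ ℓ C × Priv κ ℓ d) ℂ)
    (ρ : Matrix (Msg N × Priv κ ℓ d) (Msg N × Priv κ ℓ d) ℂ)
    (w : Cipher κ ℓ C × Priv κ ℓ d) (c c' : Cipher κ ℓ C) (x y : Msg N) : ℂ :=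
  ∑ a, ∑ a', M w (c, a) * ρ (x, a) (y, a') * star (M w (c', a'))

theorem mul_encMap_apply (hC : C.Fits κ ℓ) (H : Oracle κ ℓ) (K : KeySet κ N L) (r : TabRand κ C)
    (M : Matrix (Cipher κ ℓ C × Priv κ ℓ d) (Cipher κ ℓ C × Priv κ ℓ d) ℂ)
    (w : Cipher κ ℓ C × Priv κ ℓ d) (p : Msg N × Priv κ ℓ d) :
    (M * (encMap C hC H K r ⊗ₖ (1 : Matrix (Priv κ ℓ d) (Priv κ ℓ d) ℂ))) w p
      = M w (ctext hC H K.1 r p.1, p.2) := by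
  rw [Matrix.mul_apply, Fintype.sum_prod_type, Finset.sum_eq_single (ctext hC H K.1 r p.1)]
  · rw [Finset.sum_eq_single p.2]
    · simp [encMap, ctext]
    · intro a _ ha
      rw [Matrix.kroneckerMap_apply, Matrix.one_apply_ne ha]; simp
    · simp
  · intro c _ hc
    refine Finset.sum_eq_zero fun a _ => ?_
    rw [Matrix.kroneckerMap_apply]
    simp only [encMap, Matrix.of_apply]
    have hc' : ¬ c = (fun i => K.1 (Sum.inl i) (p.1 i), tab C hC H K.1 r) := hc
    simp [hc']
  · simp

theorem encrypt_apply_self (hC : C.Fits κ ℓ) (H : Oracle κ ℓ) (K : KeySet κ N L) (r : TabRand κ C)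
    (M : Matrix (Cipher κ ℓ C × Priv κ ℓ d) (Cipher κ ℓ C × Priv κ ℓ d) ℂ)
    (ρ : Matrix (Msg N × Priv κ ℓ d) (Msg N × Priv κ ℓ d) ℂ) (w : Cipher κ ℓ C × Priv κ ℓ d) :
    (M * encrypt C hC H K r ρ * Mᴴ) w w
      = ∑ x, ∑ y, blockTerm M ρ w (ctext hC H K.1 r x) (ctext hC H K.1 r y) x y := by
  set E := encMap C hC H K r ⊗ₖ (1 : Matrix (Priv κ ℓ d) (Priv κ ℓ d) ℂ) with hE
  have h1 : M * encrypt C hC H K r ρ * Mᴴ = (M * E) * ρ * (M * E)ᴴ := by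
    simp only [encrypt, ← hE, Matrix.conjTranspose_mul, Matrix.mul_assoc]
  rw [h1, Matrix.mul_apply]
  simp only [Matrix.mul_apply (M := M * E) (N := ρ), Matrix.conjTranspose_apply, Finset.sum_mul]
  rw [Finset.sum_comm]
  simp only [hE, mul_encMap_apply, blockTerm]
  simp only [Fintype.sum_prod_type (α₁ := Msg N)]
  refine Finset.sum_congr rfl fun x _ => ?_
  rw [Finset.sum_comm]

/-- The reduced state on the reference register is the sum of the diagonal blocks, so replacing the
message turns each of them into an encryption of `0` and discards all coherences. -/
theorem blockTerm_zeroMsg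
    (M : Matrix (Cipher κ ℓ C × Priv κ ℓ d) (Cipher κ ℓ C × Priv κ ℓ d) ℂ)
    (ρ : Matrix (Msg N × Priv κ ℓ d) (Msg N × Priv κ ℓ d) ℂ)
    (w : Cipher κ ℓ C × Priv κ ℓ d) (c : Msg N → Cipher κ ℓ C) :
    ∑ x, ∑ y, blockTerm M (zeroMsg ρ) w (c x) (c y) x y
      = ∑ x, blockTerm M ρ w (c 0) (c 0) x x := by
  have h0 : ∀ x y, ¬ (x = 0 ∧ y = 0) → blockTerm M (zeroMsg ρ) w (c x) (c y) x y = 0 := by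
    intro x y hxy
    refine Finset.sum_eq_zero fun a _ => Finset.sum_eq_zero fun a' _ => ?_
    rw [zeroMsg, Matrix.kroneckerMap_apply, Matrix.single_apply, if_neg]
    · simp
    · rintro ⟨rfl, rfl⟩; exact hxy ⟨rfl, rfl⟩
  rw [Finset.sum_eq_single 0, Finset.sum_eq_single 0]
  · simp only [blockTerm, zeroMsg, Matrix.kroneckerMap_apply, Matrix.single_apply, Matrix.of_apply,
      and_self, if_true, one_mul, Finset.mul_sum, Finset.sum_mul]
    conv_lhs =>
      arg 2; intro a
      rw [Finset.sum_comm]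
    rw [Finset.sum_comm]
  · intro y _ hy; exact h0 0 y (by simp [hy])
  · simp
  · intro x _ hx; exact Finset.sum_eq_zero fun y _ => h0 x y (by simp [hx])
  · simp

theorem blockTerm_eq_sum {J : Type*} [Fintype J]
    (M : Matrix (Cipher κ ℓ C × Priv κ ℓ d) (Cipher κ ℓ C × Priv κ ℓ d) ℂ)
    {ρ : Matrix (Msg N × Priv κ ℓ d) (Msg N × Priv κ ℓ d) ℂ} {v : J → Msg N × Priv κ ℓ d → ℂ}
    (hρ : ∀ p q, ρ p q = ∑ j, v j p * star (v j q))
    (w : Cipher κ ℓ C × Priv κ ℓ d) (c c' : Cipher κ ℓ C) (x y : Msg N) :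
    blockTerm M ρ w c c' x y
      = ∑ j, (M *ᵥ place c (block x (v j))) w * star ((M *ᵥ place c' (block y (v j))) w) := by
  simp only [mulVec_place, star_sum, Finset.sum_mul_sum]
  simp only [blockTerm, hρ, Finset.mul_sum, Finset.sum_mul, block]
  conv_lhs =>
    arg 2; intro a
    rw [Finset.sum_comm]
  rw [Finset.sum_comm]
  refine Finset.sum_congr rfl fun j _ => Finset.sum_congr rfl fun a _ =>
    Finset.sum_congr rfl fun a' _ => ?_
  rw [star_mul']
  ring

theorem mul_star_self_re (a : ℂ) : (a * star a).re = ‖a‖ ^ 2 := by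
  rw [Complex.star_def, Complex.mul_conj, Complex.ofReal_re, Complex.normSq_eq_norm_sq]

theorem sum_mem_norm_sq_eq {X : Type*} [Fintype X] [DecidableEq X] (S : Finset X) (v : X → ℂ) :
    ∑ w ∈ S, ‖v w‖ ^ 2 = nsq (basisProj S *ᵥ v) := by
  rw [basisProj_mulVec, nsq]
  rw [← Finset.sum_subset (Finset.subset_univ S)]
  · exact Finset.sum_congr rfl fun w hw => by
      rw [Set.indicator_of_mem (Finset.mem_coe.2 hw)]
  · intro w _ hw
    rw [Set.indicator_of_notMem (by simpa using hw)]; simp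

/-- Moving `M` to one side of the inner product leaves the plain vector `v` on the other. With `v`
an encryption, its support is then visible. -/
theorem sum_mem_mul_star_eq {X : Type*} [Fintype X] [DecidableEq X] (S : Finset X)
    (M : Matrix X X ℂ) (u v : X → ℂ) :
    ∑ w ∈ S, (M *ᵥ u) w * star ((M *ᵥ v) w)
      = star v ⬝ᵥ ((Mᴴ * (basisProj S * M)) *ᵥ u) := by
  rw [← Matrix.mulVec_mulVec, Matrix.dotProduct_mulVec, ← Matrix.star_mulVec,
    ← Matrix.mulVec_mulVec, basisProj_mulVec, dotProduct]
  rw [← Finset.sum_subset (Finset.subset_univ S)]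
  · exact Finset.sum_congr rfl fun w hw => by
      rw [Set.indicator_of_mem (Finset.mem_coe.2 hw), Pi.star_apply, mul_comm]
  · intro w _ hw
    rw [Set.indicator_of_notMem (by simpa using hw)]; simp

theorem star_place_dotProduct {A P : Type*} [Fintype A] [Fintype P] [DecidableEq A]
    {F : Set (A × P)} {c : A} (hc : ∀ a, (c, a) ∈ F) (u : P → ℂ) (v : A × P → ℂ) :
    star (place c u) ⬝ᵥ v = star (place c u) ⬝ᵥ F.indicator v := by
  refine Finset.sum_congr rfl fun z _ => ?_
  by_cases hz : z.1 = c
  · rw [Set.indicator_of_mem]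
    rw [show z = (c, z.2) from Prod.ext hz rfl]; exact hc _
  · simp [place, hz]

theorem card_agree_le (Q : Finset (Fin N)) (x : Msg N) :
    (Finset.univ.filter fun y : Msg N => ∀ i, i ∉ Q → x i = y i).card ≤ 2 ^ Q.card := by
  calc _ ≤ (Finset.univ : Finset (Q → Bit)).card := by
        refine Finset.card_le_card_of_injOn (fun y i => y i.1) (fun _ _ => Finset.mem_univ _) ?_
        intro y hy y' hy' h
        funext i
        by_cases hi : i ∈ Q
        · exact congrFun h ⟨i, hi⟩
        · have h1 := (Finset.mem_filter.1 (Finset.mem_coe.1 hy)).2 i hi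
          have h2 := (Finset.mem_filter.1 (Finset.mem_coe.1 hy')).2 i hi
          rw [← h1, h2]
    _ = 2 ^ Q.card := by simp [ZMod.card]

/-- Agreement outside `Q` is symmetric and each string has at most `2 ^ Q.card` partners; the terms
in `f` are counted by columns and those in `g` by rows. -/
theorem sum_agree_le (Q : Finset (Fin N)) (f g : Msg N → ℝ) (hf : ∀ x, 0 ≤ f x)
    (hg : ∀ x, 0 ≤ g x) :
    ∑ x, ∑ y, (if ∀ i, i ∉ Q → x i = y i then f y + g x else 0)
      ≤ 2 ^ Q.card * (∑ x, f x + ∑ x, g x) := by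
  have hcard : ∀ x : Msg N, ((Finset.univ.filter fun y : Msg N => ∀ i, i ∉ Q → x i = y i).card : ℝ)
      ≤ 2 ^ Q.card := fun x => by exact_mod_cast card_agree_le Q x
  have h1 : ∀ x : Msg N, ∑ y : Msg N, (if ∀ i, i ∉ Q → x i = y i then g x else 0)
      ≤ 2 ^ Q.card * g x := by
    intro x
    rw [← Finset.sum_filter, Finset.sum_const, nsmul_eq_mul]
    exact mul_le_mul_of_nonneg_right (hcard x) (hg x)
  have h2 : ∀ y : Msg N, ∑ x : Msg N, (if ∀ i, i ∉ Q → x i = y i then f y else 0)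
      ≤ 2 ^ Q.card * f y := by
    intro y
    have : ∀ x : Msg N, (∀ i, i ∉ Q → x i = y i) ↔ (∀ i, i ∉ Q → y i = x i) := fun x =>
      ⟨fun h i hi => (h i hi).symm, fun h i hi => (h i hi).symm⟩
    simp only [this]
    rw [← Finset.sum_filter, Finset.sum_const, nsmul_eq_mul]
    exact mul_le_mul_of_nonneg_right (hcard y) (hf y)
  have h3 : ∀ x y : Msg N, (if ∀ i, i ∉ Q → x i = y i then f y + g x else 0)
      = (if ∀ i, i ∉ Q → x i = y i then f y else 0)
        + (if ∀ i, i ∉ Q → x i = y i then g x else 0) := by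
    intro x y; split_ifs <;> simp
  simp only [h3, Finset.sum_add_distrib]
  rw [Finset.sum_comm, mul_add, Finset.mul_sum, Finset.mul_sum]
  exact add_le_add (Finset.sum_le_sum fun y _ => h2 y) (Finset.sum_le_sum fun x _ => h1 x)

end Expansion

/-! ### From game hops to the advantage: rewinding against coherences. -/

namespace Adversary

variable {κ ℓ N L : ℕ} {C : Circuit N L} (A : Adversary κ ℓ C)

/-- The adversary's initial state as a mixture of unnormalized pure states. -/
theorem exists_init_eq : ∃ (m : ℕ) (b : Fin m → Msg N × Priv κ ℓ A.d → ℂ),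
    (∀ p q, A.init p q = ∑ j, b j p * star (b j q)) ∧ ∑ j, nsq (b j) = 1 := by
  obtain ⟨m, b, hb⟩ := Matrix.posSemidef_iff_eq_sum_vecMulVec.1 A.init_density.1
  have h1 : ∀ p q, A.init p q = ∑ j, b j p * star (b j q) := by
    intro p q
    rw [hb]
    simp only [Matrix.sum_apply, Matrix.vecMulVec_apply, Pi.star_apply]
  refine ⟨m, b, h1, ?_⟩
  have h2 := A.init_density.2
  have h3 : (A.init.trace).re = ∑ j, nsq (b j) := by
    simp only [Matrix.trace, Matrix.diag_apply, h1, Complex.re_sum, mul_star_self_re, nsq]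
    rw [Finset.sum_comm]
  rw [← h3, h2, Complex.one_re]

/-- The operator of the first phase. -/
noncomputable def phase₁ (H : Oracle κ ℓ) : Matrix (Msg N × Priv κ ℓ A.d) (Msg N × Priv κ ℓ A.d) ℂ :=
  runOp H A.U₁ A.q₁

/-- The operator of the second phase, projected to acceptance. -/
noncomputable def phase₂ (H : Oracle κ ℓ) :
    Matrix (Cipher κ ℓ C × Priv κ ℓ A.d) (Cipher κ ℓ C × Priv κ ℓ A.d) ℂ :=
  basisProj A.accept * runOp H A.U₂ A.q₂

/-- The second phase, projected to acceptance and undone. -/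
noncomputable def rewind (H : Oracle κ ℓ) :
    Matrix (Cipher κ ℓ C × Priv κ ℓ A.d) (Cipher κ ℓ C × Priv κ ℓ A.d) ℂ :=
  (runOp H A.U₂ A.q₂)ᴴ * (basisProj A.accept * runOp H A.U₂ A.q₂)

theorem isQueryAlg_phase₁ : IsQueryAlg A.q₁ A.phase₁ := isQueryAlg_runOp _ _

theorem isQueryAlg_phase₂ : IsQueryAlg A.q₂ A.phase₂ :=
  (isQueryAlg_runOp _ _).mul_left (contr_basisProj _)

theorem isQueryAlg_rewind : IsQueryAlg (A.q₂ + A.q₂) A.rewind :=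
  IsQueryAlg.runOp_conjTranspose_mul _ _ A.isQueryAlg_phase₂

variable {A}

theorem submitted_eq {J : Type*} [Fintype J]
    {b : J → Msg N × Priv κ ℓ A.d → ℂ}
    (hb : ∀ p q, A.init p q = ∑ j, b j p * star (b j q)) (H : Oracle κ ℓ)
    (p q : Msg N × Priv κ ℓ A.d) :
    A.submitted H p q = ∑ j, (A.phase₁ H *ᵥ b j) p * star ((A.phase₁ H *ᵥ b j) q) := by
  have h1 : A.init = ∑ j, Matrix.vecMulVec (b j) (star (b j)) := by
    ext p q
    simp only [Matrix.sum_apply, Matrix.vecMulVec_apply, Pi.star_apply, hb]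
  rw [submitted, h1, Matrix.mul_sum, Matrix.sum_mul, Matrix.sum_apply]
  refine Finset.sum_congr rfl fun j _ => ?_
  rw [Matrix.mul_vecMulVec, Matrix.vecMulVec_mul, ← Matrix.star_mulVec, Matrix.vecMulVec_apply,
    Pi.star_apply]
  rfl

/-- The event that the ciphertext register holds an inactive key of an input wire. -/
def keyFound (κ ℓ : ℕ) (C : Circuit N L) (d : ℕ) (K₁ : Wire N L → BV κ) :
    Set (Cipher κ ℓ C × Priv κ ℓ d) :=
  {y | ∃ i : Fin N, y.1.1 i = K₁ (Sum.inl i)}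

variable {J : Type*} [Fintype J] {b : J → Msg N × Priv κ ℓ A.d → ℂ}

theorem acceptProb_zeroMsg (hC : C.Fits κ ℓ)
    (hb : ∀ p q, A.init p q = ∑ j, b j p * star (b j q))
    (K : KeySet κ N L) (H : Oracle κ ℓ) (r : TabRand κ C) :
    A.acceptProb H (encrypt C hC H K r (zeroMsg (A.submitted H)))
      = ∑ j, ∑ x, gameWeight C hC A.phase₂ A.phase₁ (b j) (fun _ => Set.univ) 0 x K.1 H r := by
  simp only [acceptProb, encrypt_apply_self, blockTerm_zeroMsg]
  simp only [blockTerm_eq_sum _ (submitted_eq hb H), Complex.re_sum, mul_star_self_re]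
  have h1 : ∀ j x, gameWeight C hC A.phase₂ A.phase₁ (b j) (fun _ => Set.univ) 0 x K.1 H r
      = ∑ w ∈ A.accept, ‖(runOp H A.U₂ A.q₂ *ᵥ place (ctext hC H K.1 r 0)
        (block x (A.phase₁ H *ᵥ b j))) w‖ ^ 2 := by
    intro j x
    rw [sum_mem_norm_sq_eq, gameWeight, Set.indicator_univ, outVec, phase₂, Matrix.mulVec_mulVec]
    rfl
  simp only [h1]
  rw [Finset.sum_comm]
  conv_rhs => rw [Finset.sum_comm]
  refine Finset.sum_congr rfl fun x _ => ?_
  rw [Finset.sum_comm]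

/-- Only off-diagonal blocks remain in the difference. Each is at most the overlap of the rewound
run on the encryption of `x` with the encryption of `y`, hence is controlled by the weight of that
run on the inactive keys of `x`. -/
theorem acceptProb_sub_le (hC : C.Fits κ ℓ) {Q : Finset (Fin N)} (hQ : A.ClassicalOutside Q)
    (hb : ∀ p q, A.init p q = ∑ j, b j p * star (b j q))
    (K : KeySet κ N L) (H : Oracle κ ℓ) (r : TabRand κ C) {s : ℝ} (hs : 0 < s) :
    |A.acceptProb H (encrypt C hC H K r (A.submitted H))
      - ∑ j, ∑ x, gameWeight C hC A.phase₂ A.phase₁ (b j) (fun _ => Set.univ) x x K.1 H r|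
      ≤ 2 ^ Q.card * ∑ j, (s * nsq (b j) + s⁻¹ * ∑ x,
        gameWeight C hC A.rewind A.phase₁ (b j) (keyFound κ ℓ C A.d) x x K.1 H r) := by
  classical
  set c := ctext hC H K.1 r with hc
  set M := runOp (A := Cipher κ ℓ C) H A.U₂ A.q₂ with hM
  set v := fun j => A.phase₁ H *ᵥ b j with hv
  set T : Msg N → Msg N → ℂ := fun x y =>
    ∑ w ∈ A.accept, blockTerm M (A.submitted H) w (c x) (c y) x y with hT
  set g := fun j x => gameWeight C hC A.rewind A.phase₁ (b j) (keyFound κ ℓ C A.d) x x K.1 H r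
    with hg
  have hreal : A.acceptProb H (encrypt C hC H K r (A.submitted H)) = ∑ x, ∑ y, (T x y).re := by
    simp only [acceptProb, encrypt_apply_self, hT, Complex.re_sum]
    rw [Finset.sum_comm]
    refine Finset.sum_congr rfl fun x _ => ?_
    rw [Finset.sum_comm]
  have hdiag : ∑ j, ∑ x, gameWeight C hC A.phase₂ A.phase₁ (b j) (fun _ => Set.univ) x x K.1 H r
      = ∑ x, (T x x).re := by
    rw [Finset.sum_comm]
    refine Finset.sum_congr rfl fun x _ => ?_
    simp only [hT, blockTerm_eq_sum _ (submitted_eq hb H), Complex.re_sum, mul_star_self_re]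
    rw [Finset.sum_comm]
    refine Finset.sum_congr rfl fun j _ => ?_
    rw [sum_mem_norm_sq_eq, gameWeight, Set.indicator_univ, outVec, phase₂, Matrix.mulVec_mulVec]
    rfl
  have hTeq : ∀ x y, T x y = ∑ j, star (place (c y) (block y (v j)))
      ⬝ᵥ (A.rewind H *ᵥ place (c x) (block x (v j))) := by
    intro x y
    simp only [hT, blockTerm_eq_sum _ (submitted_eq hb H)]
    rw [Finset.sum_comm]
    exact Finset.sum_congr rfl fun j _ => sum_mem_mul_star_eq _ _ _ _
  have hoff : ∀ x y, x ≠ y → ‖T x y‖ ≤ if ∀ i, i ∉ Q → x i = y i then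
      s * ∑ j, nsq (block y (v j)) + s⁻¹ * ∑ j, g j x else 0 := by
    intro x y hxy
    split_ifs with hag
    · rw [hTeq, Finset.mul_sum, Finset.mul_sum, ← Finset.sum_add_distrib]
      refine (norm_sum_le _ _).trans (Finset.sum_le_sum fun j _ => ?_)
      -- At a position where `x` and `y` differ, the encryption of `y` shows the key that is
      -- inactive for `x`.
      have hmem : ∀ a, (c y, a) ∈ keyFound κ ℓ C A.d (fun w => K.1 w (wireVal C x w + 1)) := by
        intro a
        obtain ⟨i, hi⟩ := Function.ne_iff.1 hxy
        refine ⟨i, ?_⟩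
        change K.1 (Sum.inl i) (y i) = K.1 (Sum.inl i) (x i + 1)
        have hbit : ∀ p q : Bit, p ≠ q → q = p + 1 := by decide
        rw [hbit _ _ hi]
      rw [star_place_dotProduct hmem]
      refine (norm_dotProduct_le _ _ hs).trans (le_of_eq ?_)
      rw [nsq_place]
      rfl
    · push Not at hag
      obtain ⟨i, hi, hne⟩ := hag
      have h0 : T x y = 0 := by
        refine Finset.sum_eq_zero fun w _ => ?_
        refine Finset.sum_eq_zero fun a _ => Finset.sum_eq_zero fun a' _ => ?_
        rw [hQ H x y a a' ⟨i, hi, hne⟩]; simp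
      rw [h0, norm_zero]
  have hg0 : ∀ j x, 0 ≤ g j x := fun j x => nsq_nonneg _
  have hrhs0 : ∀ x y, 0 ≤ if ∀ i, i ∉ Q → x i = y i then
      s * ∑ j, nsq (block y (v j)) + s⁻¹ * ∑ j, g j x else 0 := by
    intro x y
    split_ifs
    · have := Finset.sum_nonneg fun j (_ : j ∈ Finset.univ) => nsq_nonneg (block y (v j))
      have := Finset.sum_nonneg fun j (_ : j ∈ Finset.univ) => hg0 j x
      positivity
    · exact le_rfl
  rw [hreal, hdiag, ← Finset.sum_sub_distrib]
  have hrow : ∀ x, |∑ y, (T x y).re - (T x x).re| ≤ ∑ y, if ∀ i, i ∉ Q → x i = y i then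
      s * ∑ j, nsq (block y (v j)) + s⁻¹ * ∑ j, g j x else 0 := by
    intro x
    rw [← Finset.sum_erase_eq_sub (Finset.mem_univ x)]
    refine (Finset.abs_sum_le_sum_abs _ _).trans ((Finset.sum_le_sum fun y hy =>
      (Complex.abs_re_le_norm _).trans (hoff x y (Finset.ne_of_mem_erase hy).symm)).trans ?_)
    exact Finset.sum_le_sum_of_subset_of_nonneg (Finset.erase_subset _ _) fun y _ _ => hrhs0 x y
  refine (Finset.abs_sum_le_sum_abs _ _).trans ((Finset.sum_le_sum fun x _ => hrow x).trans ?_)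
  refine (sum_agree_le Q (fun y => s * ∑ j, nsq (block y (v j))) (fun x => s⁻¹ * ∑ j, g j x)
    (fun y => mul_nonneg hs.le (Finset.sum_nonneg fun j _ => nsq_nonneg _))
    (fun x => mul_nonneg (inv_pos.2 hs).le (Finset.sum_nonneg fun j _ => hg0 j x))).trans ?_
  refine mul_le_mul_of_nonneg_left ?_ (by positivity)
  rw [← Finset.mul_sum, ← Finset.mul_sum, Finset.sum_comm, Finset.sum_add_distrib,
    ← Finset.mul_sum, ← Finset.mul_sum]
  simp only [sum_nsq_block]
  have h1 : ∑ j, nsq (v j) ≤ ∑ j, nsq (b j) :=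
    Finset.sum_le_sum fun j _ => A.isQueryAlg_phase₁.1 H (b j)
  have h2 := mul_le_mul_of_nonneg_left h1 hs.le
  rw [Finset.sum_comm (f := fun x j => g j x)]
  linarith

/-- The average of the game over a mixture of initial states. -/
theorem abs_expect_sum_game_sub_le [Nonempty (KeySet κ N L)] {hC : C.Fits κ ℓ}
    (hb1 : ∑ j, nsq (b j) = 1) {n : ℕ}
    {V : Oracle κ ℓ → Matrix (Cipher κ ℓ C × Priv κ ℓ A.d) (Cipher κ ℓ C × Priv κ ℓ A.d) ℂ}
    (hV : IsQueryAlg n V) (D : (Wire N L → BV κ) → Set (Cipher κ ℓ C × Priv κ ℓ A.d))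
    (z : Msg N → Msg N) {s : ℝ} (hs : 0 < s) :
    |(𝔼 K : KeySet κ N L, 𝔼 H, 𝔼 r, ∑ j, ∑ x,
        gameWeight C hC V A.phase₁ (b j) D (z x) x K.1 H r)
      - ∑ j, 𝔼 ω : Sample κ ℓ C, ∑ x,
        nsq ((D ω.1.1.2).indicator (idealVec C hC V A.phase₁ (b j) x ω))|
      ≤ gameErr κ N L A.q₁ n s := by
  have h1 : ∀ K : KeySet κ N L, ∀ H, 𝔼 r, ∑ j, ∑ x,
      gameWeight C hC V A.phase₁ (b j) D (z x) x K.1 H r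
      = ∑ j, 𝔼 r, ∑ x, gameWeight C hC V A.phase₁ (b j) D (z x) x K.1 H r := fun K H => by
    rw [Finset.expect_sum_comm]
  have h2 : ∀ K : KeySet κ N L, 𝔼 H, ∑ j, 𝔼 r, ∑ x,
      gameWeight C hC V A.phase₁ (b j) D (z x) x K.1 H r
      = ∑ j, 𝔼 H, 𝔼 r, ∑ x, gameWeight C hC V A.phase₁ (b j) D (z x) x K.1 H r := fun K => by
    rw [Finset.expect_sum_comm]
  simp only [h1, h2]
  rw [Finset.expect_sum_comm, ← Finset.sum_sub_distrib]
  refine (Finset.abs_sum_le_sum_abs _ _).trans ((Finset.sum_le_sum fun j _ =>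
    abs_expect_game_sub_le (hC := hC) (b := b j) hV A.isQueryAlg_phase₁ D z hs).trans ?_)
  rw [← Finset.mul_sum, hb1, mul_one]

theorem abs_expect_sub_le {ι₁ ι₂ ι₃ : Type*} [Fintype ι₁] [Fintype ι₂] [Fintype ι₃]
    (f g h : ι₁ → ι₂ → ι₃ → ℝ) (hfg : ∀ i j k, |f i j k - g i j k| ≤ h i j k) :
    |(𝔼 i, 𝔼 j, 𝔼 k, f i j k) - 𝔼 i, 𝔼 j, 𝔼 k, g i j k| ≤ 𝔼 i, 𝔼 j, 𝔼 k, h i j k := by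
  simp only [← Finset.expect_sub_distrib]
  refine (Finset.abs_expect_le _ _).trans (expect_mono fun i => ?_)
  refine (Finset.abs_expect_le _ _).trans (expect_mono fun j => ?_)
  exact (Finset.abs_expect_le _ _).trans (expect_mono fun k => hfg i j k)

theorem nonempty_keySet (hκ : 0 < κ) : Nonempty (KeySet κ N L) :=
  ⟨⟨fun _ b _ => b, fun _ h => by simpa using congrFun h ⟨0, hκ⟩⟩⟩

/-- The advantage in terms of the errors of the game hops. -/
theorem advantage_le (hκ : 0 < κ) (hC : C.Fits κ ℓ) {Q : Finset (Fin N)}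
    (hQ : A.ClassicalOutside Q) {s t : ℝ} (hs : 0 < s) (ht : 0 < t) :
    A.advantage hC ≤ 2 * gameErr κ N L A.q₁ A.q₂ t
      + 2 ^ Q.card * (s + s⁻¹ * (gameErr κ N L A.q₁ (A.q₂ + A.q₂) t + N / 2 ^ κ)) := by
  have := nonempty_keySet (N := N) (L := L) hκ
  obtain ⟨m, b, hb, hb1⟩ := A.exists_init_eq
  have h1 := abs_expect_sub_le
    (fun (K : KeySet κ N L) H r => A.acceptProb H (encrypt C hC H K r (A.submitted H)))
    (fun K H r => ∑ j, ∑ x,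
      gameWeight C hC A.phase₂ A.phase₁ (b j) (fun _ => Set.univ) x x K.1 H r) _
    (fun K H r => acceptProb_sub_le hC hQ hb K H r hs)
  -- The first two comparisons, encrypting `x` as itself and as `0`, lead to the same ideal game.
  -- The third bounds the success of rewinding.
  have h2 := abs_expect_sum_game_sub_le (hC := hC) hb1 A.isQueryAlg_phase₂ (fun _ => Set.univ)
    (fun x => x) ht
  have h3 := abs_expect_sum_game_sub_le (hC := hC) hb1 A.isQueryAlg_phase₂ (fun _ => Set.univ)
    (fun _ => 0) ht
  have h4 := abs_expect_sum_game_sub_le (hC := hC) hb1 A.isQueryAlg_rewind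
    (keyFound κ ℓ C A.d) (fun x => x) ht
  have h5 : ∑ j, 𝔼 ω : Sample κ ℓ C, ∑ x, nsq ((keyFound κ ℓ C A.d ω.1.1.2).indicator
      (idealVec C hC A.rewind A.phase₁ (b j) x ω)) ≤ N / 2 ^ κ := by
    have h6 : ∀ j, 𝔼 ω : Sample κ ℓ C, ∑ x, nsq ((keyFound κ ℓ C A.d ω.1.1.2).indicator
        (idealVec C hC A.rewind A.phase₁ (b j) x ω)) ≤ N / 2 ^ κ * nsq (b j) := by
      intro j
      have := expect_idealVec_hit_le (hC := hC) (b := b j) A.isQueryAlg_rewind.1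
        A.isQueryAlg_phase₁.1 (fun i : Fin N => Sum.inl i) (fun i y => y.1.1 i)
      rwa [Fintype.card_fin] at this
    refine (Finset.sum_le_sum fun j _ => h6 j).trans ?_
    rw [← Finset.mul_sum, hb1, mul_one]
  have h6 : 𝔼 K : KeySet κ N L, 𝔼 H, 𝔼 r, (2 : ℝ) ^ Q.card * ∑ j, (s * nsq (b j) + s⁻¹ * ∑ x,
      gameWeight C hC A.rewind A.phase₁ (b j) (keyFound κ ℓ C A.d) x x K.1 H r)
      = 2 ^ Q.card * (s + s⁻¹ * 𝔼 K : KeySet κ N L, 𝔼 H, 𝔼 r, ∑ j, ∑ x,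
      gameWeight C hC A.rewind A.phase₁ (b j) (keyFound κ ℓ C A.d) x x K.1 H r) := by
    simp only [Finset.sum_add_distrib, ← Finset.mul_sum, hb1, mul_one, ← Finset.mul_expect,
      Finset.expect_add_distrib, Fintype.expect_const]
  rw [h6] at h1
  have h7 : A.probZero hC = 𝔼 K : KeySet κ N L, 𝔼 H, 𝔼 r, ∑ j, ∑ x,
      gameWeight C hC A.phase₂ A.phase₁ (b j) (fun _ => Set.univ) 0 x K.1 H r := by
    simp only [probZero, acceptProb_zeroMsg hC hb]
  have h8 := (abs_le.1 h4).2
  have h9 : (2 : ℝ) ^ Q.card * (s + s⁻¹ * 𝔼 K : KeySet κ N L, 𝔼 H, 𝔼 r, ∑ j, ∑ x,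
      gameWeight C hC A.rewind A.phase₁ (b j) (keyFound κ ℓ C A.d) x x K.1 H r)
      ≤ 2 ^ Q.card * (s + s⁻¹ * (gameErr κ N L A.q₁ (A.q₂ + A.q₂) t + N / 2 ^ κ)) := by
    gcongr
    linarith
  have h10 := h1.trans h9
  rw [advantage, h7]
  rw [abs_le] at h2 h3 h10 ⊢
  simp only [probReal]
  constructor <;> linarith [h2.1, h2.2, h3.1, h3.2, h10.1, h10.2]

end Adversary

/-! ### Choice of parameters and the polynomial bound. -/

/-- The polynomial bounding the game error, for `m` queries in the first and `n` queries in the second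
phase. -/
def errPoly {S : Type*} [CommSemiring S] (m n N L : S) : S :=
  2 * (2 * (N + 3 * L)) ^ 2 + (96 * L) ^ 2
    + (2 * (m * (m * (4 * (2 * (N + 3 * L)))))
      + 2 * (n * (n * (4 * ((N + 3 * L) + (96 * L) ^ 2))))) + 2

/-- The polynomial of the advantage bound in the number of queries, qubits and gates. -/
def advPoly {S : Type*} [CommSemiring S] (q N L : S) : S := 3 * errPoly q (2 * q) N L + 1 + N

theorem errPoly_mono {m m' n n' N N' L L' : ℝ} (hm : 0 ≤ m) (hn : 0 ≤ n) (hN : 0 ≤ N) (hL : 0 ≤ L)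
    (hm' : m ≤ m') (hn' : n ≤ n') (hN' : N ≤ N') (hL' : L ≤ L') :
    errPoly m n N L ≤ errPoly m' n' N' L' := by
  have hm0 := hm.trans hm'
  have hn0 := hn.trans hn'
  unfold errPoly
  gcongr

theorem advPoly_mono {q q' N N' L L' : ℝ} (hq : 0 ≤ q) (hN : 0 ≤ N) (hL : 0 ≤ L)
    (hq' : q ≤ q') (hN' : N ≤ N') (hL' : L ≤ L') : advPoly q N L ≤ advPoly q' N' L' := by
  unfold advPoly
  have := errPoly_mono hq (by linarith : 0 ≤ 2 * q) hN hL hq' (by linarith : 2 * q ≤ 2 * q') hN' hL'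
  linarith

/-- All probabilities are of order `t ^ 4`. The parameter `t ^ 2` balances `s⁻¹ * t ^ 4` against
`s`. -/
theorem gameErr_le (κ N L m n : ℕ) {t : ℝ} (ht : 0 < t) (ht1 : t ≤ 1)
    (htκ : ((2 : ℝ) ^ κ)⁻¹ = t ^ 4) :
    gameErr κ N L m n (t ^ 2) ≤ t ^ 2 * errPoly (m : ℝ) n N L := by
  have h2 : t ^ 4 ≤ t ^ 2 := pow_le_pow_of_le_one ht.le ht1 (by norm_num)
  have e1 : gameErr κ N L m n (t ^ 2)
      = t ^ 4 * (2 * (2 * ((N : ℝ) + 3 * L)) ^ 2 + (96 * L) ^ 2)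
        + t ^ 2 * ((2 * (m * (m * (4 * (2 * ((N : ℝ) + 3 * L)))))
      + 2 * (n * (n * (4 * (((N : ℝ) + 3 * L) + (96 * L) ^ 2)))))) + t ^ 2 * 2 := by
    simp only [gameErr, keyColl, padColl, reprogErr, guessProb, div_eq_mul_inv, htκ]
    field_simp
  have e2 : t ^ 4 * (2 * (2 * ((N : ℝ) + 3 * L)) ^ 2 + (96 * L) ^ 2)
      ≤ t ^ 2 * (2 * (2 * ((N : ℝ) + 3 * L)) ^ 2 + (96 * L) ^ 2) := by gcongr
  rw [e1, errPoly]
  linarith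

theorem advantage_le_advPoly {κ ℓ N L q : ℕ} {C : Circuit N L} (hC : C.Fits κ ℓ)
    {Q : Finset (Fin N)} (A : Adversary κ ℓ C) (hκ : 0 < κ) (hQ : A.ClassicalOutside Q)
    (hq : A.queries ≤ q) :
    A.advantage hC ≤ advPoly (q : ℝ) N L
      * (2 : ℝ) ^ (-(1 / 4 : ℝ) * ((κ : ℝ) - 4 * (Q.card : ℝ))) := by
  set t : ℝ := (2 : ℝ) ^ (-(1 / 4 : ℝ) * κ) with ht_def
  have ht : 0 < t := by positivity
  have ht1 : t ≤ 1 := Real.rpow_le_one_of_one_le_of_nonpos (by norm_num)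
    (by have : (0 : ℝ) ≤ κ := Nat.cast_nonneg κ
        linarith)
  have htκ : ((2 : ℝ) ^ κ)⁻¹ = t ^ 4 := by
    rw [ht_def, ← Real.rpow_natCast, ← Real.rpow_natCast, ← Real.rpow_mul (by norm_num),
      ← Real.rpow_neg (by norm_num)]
    congr 1; push_cast; ring
  have htQ : (2 : ℝ) ^ (-(1 / 4 : ℝ) * ((κ : ℝ) - 4 * (Q.card : ℝ))) = 2 ^ Q.card * t := by
    rw [ht_def, ← Real.rpow_natCast, ← Real.rpow_add (by norm_num)]
    congr 1; ring
  have hq1 : (A.q₁ : ℝ) ≤ q := by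
    exact_mod_cast (Nat.le_add_right _ _).trans hq
  have hq2 : (A.q₂ : ℝ) ≤ q := by
    exact_mod_cast (Nat.le_add_left _ _).trans hq
  have hqn : (0 : ℝ) ≤ q := Nat.cast_nonneg q
  -- The game error is of order `t ^ 2`, so the weight `t` balances the two terms of the overlap
  -- bound and leaves order `t = 2^{-κ/4}`.
  have h := A.advantage_le hκ hC hQ ht (pow_pos ht 2)
  set E := errPoly (q : ℝ) (2 * q) N L with hE
  have g1 : gameErr κ N L A.q₁ A.q₂ (t ^ 2) ≤ t ^ 2 * E := by
    refine (gameErr_le κ N L _ _ ht ht1 htκ).trans ?_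
    refine mul_le_mul_of_nonneg_left ?_ (by positivity)
    exact errPoly_mono (by positivity) (by positivity) (by positivity) (by positivity) hq1
      (by linarith) le_rfl le_rfl
  have g2 : gameErr κ N L A.q₁ (A.q₂ + A.q₂) (t ^ 2) ≤ t ^ 2 * E := by
    refine (gameErr_le κ N L _ _ ht ht1 htκ).trans ?_
    refine mul_le_mul_of_nonneg_left ?_ (by positivity)
    exact errPoly_mono (by positivity) (by positivity) (by positivity) (by positivity) hq1
      (by push_cast; linarith) le_rfl le_rfl
  have hE0 : 0 ≤ E := by rw [hE]; unfold errPoly; positivity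
  have hN : (0 : ℝ) ≤ N := Nat.cast_nonneg N
  have hQ1 : (1 : ℝ) ≤ 2 ^ Q.card := one_le_pow₀ (by norm_num)
  have ht2 : t ^ 2 ≤ t := by nlinarith
  have ht3 : t ^ 3 ≤ t := by
    calc t ^ 3 ≤ t ^ 1 := pow_le_pow_of_le_one ht.le ht1 (by norm_num)
      _ = t := pow_one t
  have k1 : 2 * gameErr κ N L A.q₁ A.q₂ (t ^ 2) ≤ 2 ^ Q.card * (t * (2 * E)) := by
    calc 2 * gameErr κ N L A.q₁ A.q₂ (t ^ 2) ≤ 2 * (t * E) := by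
          refine mul_le_mul_of_nonneg_left (g1.trans ?_) (by norm_num)
          gcongr
      _ = 1 * (t * (2 * E)) := by ring
      _ ≤ _ := by gcongr
  have k2 : t + t⁻¹ * (gameErr κ N L A.q₁ (A.q₂ + A.q₂) (t ^ 2) + N / 2 ^ κ)
      ≤ t * (1 + E + N) := by
    calc t + t⁻¹ * (gameErr κ N L A.q₁ (A.q₂ + A.q₂) (t ^ 2) + N / 2 ^ κ)
        ≤ t + t⁻¹ * (t ^ 2 * E + N * t ^ 4) := by
          rw [div_eq_mul_inv, htκ]
          gcongr
      _ = t + t * E + N * t ^ 3 := by field_simp; ring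
      _ ≤ t + t * E + N * t := by gcongr
      _ = _ := by ring
  have k3 := mul_le_mul_of_nonneg_left k2 (by positivity : (0 : ℝ) ≤ 2 ^ Q.card)
  rw [htQ, advPoly, ← hE]
  linarith

theorem superpolynomialDecay_rpow :
    Asymptotics.SuperpolynomialDecay Filter.atTop (fun η : ℕ => (η : ℝ))
      (fun η : ℕ => (2 : ℝ) ^ (-(1 / 4 : ℝ) * η)) := by
  intro n
  have h : ∀ η : ℕ, (2 : ℝ) ^ (-(1 / 4 : ℝ) * η) = ((2 : ℝ) ^ (-(1 / 4 : ℝ))) ^ η := fun η => by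
    rw [Real.rpow_mul (by norm_num), Real.rpow_natCast]
  simp only [h]
  exact tendsto_pow_const_mul_const_pow_of_lt_one n (by positivity)
    (Real.rpow_lt_one_of_one_lt_of_neg (by norm_num) (by norm_num))

end GBC

theorem theorem6 :
    (∃ p : MvPolynomial (Fin 3) ℝ,
      ∀ (κ ℓ N L q : ℕ) (C : GBC.Circuit N L) (hC : GBC.Circuit.Fits C κ ℓ)
        (Q : Finset (Fin N)) (A : GBC.Adversary κ ℓ C),
        0 < κ → A.ClassicalOutside Q → A.queries ≤ q →
        A.advantage hC ≤
          MvPolynomial.eval ![(q : ℝ), (N : ℝ), (L : ℝ)] p *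
            (2 : ℝ) ^ (-(1 / 4 : ℝ) * ((κ : ℝ) - 4 * (Q.card : ℝ)))) ∧
    (∀ (κ ℓ N L : ℕ → ℕ) (C : (η : ℕ) → GBC.Circuit (N η) (L η))
        (hC : (η : ℕ) → GBC.Circuit.Fits (C η) (κ η) (ℓ η))
        (Q : (η : ℕ) → Finset (Fin (N η)))
        (A : (η : ℕ) → GBC.Adversary (κ η) (ℓ η) (C η)),
        (∀ η, κ η = η + 4 * (Q η).card) →
        (∀ η, (A η).ClassicalOutside (Q η)) →
        (∃ b : Polynomial ℕ, ∀ η, N η + L η + (A η).queries ≤ b.eval η) →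
        Asymptotics.SuperpolynomialDecay Filter.atTop (fun η : ℕ => (η : ℝ))
          (fun η => (A η).advantage (hC η))) := by
  constructor
  · refine ⟨GBC.advPoly (MvPolynomial.X 0) (MvPolynomial.X 1) (MvPolynomial.X 2), ?_⟩
    intro κ ℓ N L q C hC Q A hκ hQ hq
    have h := GBC.advantage_le_advPoly hC A hκ hQ hq
    have he : MvPolynomial.eval ![(q : ℝ), (N : ℝ), (L : ℝ)]
        (GBC.advPoly (MvPolynomial.X 0) (MvPolynomial.X 1) (MvPolynomial.X 2))
        = GBC.advPoly (q : ℝ) N L := by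
      simp [GBC.advPoly, GBC.errPoly]
    rwa [he]
  · rintro κ ℓ N L C hC Q A hκ hQ ⟨b, hb⟩
    set B : Polynomial ℝ := b.map (Nat.castRingHom ℝ) with hB
    have hBe : ∀ η : ℕ, B.eval (η : ℝ) = (b.eval η : ℕ) := fun η => by
      rw [hB, Polynomial.eval_natCast_map]; simp
    refine (GBC.superpolynomialDecay_rpow.polynomial_mul
      (GBC.advPoly B B B)).trans_eventually_abs_le ?_
    -- Excluding `η = 0` guarantees a positive key length.
    filter_upwards [Filter.eventually_gt_atTop 0] with η hη
    have h := GBC.advantage_le_advPoly (hC η) (A η) (by rw [hκ]; omega) (hQ η) le_rfl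
    have hexp : ((κ η : ℝ) - 4 * ((Q η).card : ℝ)) = η := by rw [hκ]; push_cast; ring
    rw [hexp] at h
    have hle : GBC.advPoly ((A η).queries : ℝ) (N η) (L η)
        ≤ (GBC.advPoly B B B : Polynomial ℝ).eval (η : ℝ) := by
      have he : (GBC.advPoly B B B : Polynomial ℝ).eval (η : ℝ)
          = GBC.advPoly ((b.eval η : ℕ) : ℝ) ((b.eval η : ℕ) : ℝ) ((b.eval η : ℕ) : ℝ) := by
        simp [GBC.advPoly, GBC.errPoly, hBe]
      rw [he]
      have := hb η
      refine GBC.advPoly_mono (Nat.cast_nonneg _) (Nat.cast_nonneg _) (Nat.cast_nonneg _) ?_ ?_ ?_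
      · exact_mod_cast (by omega : (A η).queries ≤ b.eval η)
      · exact_mod_cast (by omega : N η ≤ b.eval η)
      · exact_mod_cast (by omega : L η ≤ b.eval η)
    have h0 : 0 ≤ (A η).advantage (hC η) := abs_nonneg _
    simp only [Function.comp_apply]
    rw [abs_of_nonneg h0]
    refine le_trans ?_ (le_abs_self _)
    refine h.trans ?_
    exact mul_le_mul_of_nonneg_right hle (by positivity)
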